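/- Notation. Label the letters $0,1,\infty$. For a letter $\alpha$ let $\mathbb Q^{(\alpha)}$ be the set of rationals $p/q$ in lowest terms, $q>0$, with $(p,q)$ even/odd if $\alpha=0$, odd/odd if $\alpha=1$, odd/even if $\alpha=\infty$, and put $\mathbb Q^{(\alpha,\beta)}=\mathbb Q^{(\alpha)}\cup\mathbb Q^{(\beta)}$. Let $x$ be an irrational real number. For a set $Q$ of rationals, call $p/q\in Q$ (in lowest terms, $q>0$) a best approximation of $x$ in $Q$ if $|qx-p|<|bx-a|$ for every $a/b\in Q$ in lowest terms, other than $p/q$, with $0<b\le q$. The sets $\mathscr B(x)$, $\mathscr B^{(\alpha)}(x)$, $\mathscr B^{(\alpha,\beta)}(x)$ consist of the best approximations of $x$ in $\mathbb Q$, $\mathbb Q^{(\alpha)}$, $\mathbb Q^{(\alpha,\beta)}$ respectively. $\mathscr S(x)$ is the set of best signed approximations: those $p/q$ such that every $a/b$ in lowest terms, other than $p/q$, with $0<b\le q$ and $\operatorname{sgn}(bx-a)=\operatorname{sgn}(qx-p)$ satisfies $bx-a<qx-p<0$ or $0<qx-p<bx-a$. Let $$H_0=\begin{pmatrix}-1&2\\0&1\end{pmatrix},\quad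 H_1=\begin{pmatrix}-1&0\\0&1\end{pmatrix},\quad H_\infty=\begin{pmatrix}1&0\\2&-1\end{pmatrix}$$ act on $\mathbb R\cup\{\infty\}$ by fractional linear transformations, and let $I_0=[1,\infty]$, $I_1=[-\infty,0]$ (with $-\infty=\infty$), $I_\infty=[0,1]$. For a sequence of letters with $\alpha_i\ne\alpha_{i+1}$ for all $i\ge1$ and $y\in\mathbb R\cup\{\infty\}$, write $y=[\alpha_1,\alpha_2,\dots]_\Delta$ (a $\Delta$-expression of $y$) if $(H_{\alpha_1}\cdots H_{\alpha_{m-1}})^{-1}\cdot y\in I_{\alpha_m}$ for all $m\ge1$. An overline denotes periodic repetition. Theorem. Let $x=[\alpha_1,\alpha_2,\dots]_\Delta$ be irrational, let $a_0=\lfloor x\rfloor$, and for $m\ge1$ let $\delta_{m+1}$ be the letter with $\{\alpha_m,\alpha_{m+1},\delta_{m+1}\}=\{0,1,\infty\}$. Then, for all $m\ge 1$ and every letter $c\ne\alpha_m$, the sequence $\alpha_1,\dots,\alpha_{m-1},\overline{\alpha_m,c}$ is a $\Delta$-expression of exactly one point, and \begin{align*} \mathscr B(x)&=\{[\alpha_1,\dots,\alpha_{m-1},\overline{\alpha_m,\alpha_{m+1}}]_\Delta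 : m\ge|a_0|+1\},\\ \mathscr S(x)&=\{[\alpha_1,\dots,\alpha_{m-1},\overline{\alpha_m,\delta_{m+1}}]_\Delta : m\ge|a_0|+1\},\\ \mathscr B^{(\alpha)}(x)&=\{[\alpha_1,\dots,\alpha_{m-1},\overline{\alpha_m,\delta_{m+1}}]_\Delta : \alpha_{m+1}=\alpha,\ m\ge|a_0|+1\},\\ \mathscr B^{(\alpha,\beta)}(x)&=\{[\alpha_1,\dots,\alpha_{m-1},\overline{\alpha_m,\gamma}]_\Delta : \alpha_m\ne\gamma,\ m\ge|a_0|+1\}, \end{align*} for every letter $\alpha$ in the third line and all $\alpha,\beta,\gamma$ with $\{\alpha,\beta,\gamma\}=\{0,1,\infty\}$ in the fourth. In particular all these points are rational (none is $\infty$). -/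

import Mathlib

/-- The three letters `0`, `1`, `∞`. They label the three parity classes of rational numbers as well
as the three reflections generating the triangle group. -/
inductive Letter
  | zero
  | one
  | inf

/-- The parity class of rational numbers (in lowest terms) of a given letter:
`0` is even/odd, `1` is odd/odd, `∞` is odd/even. -/
def parityClass : Letter → Set ℚ
  | Letter.zero => {r | Even r.num ∧ Odd r.den}
  | Letter.one => {r | Odd r.num ∧ Odd r.den}
  | Letter.inf => {r | Odd r.num ∧ Even r.den}

/-- The signed error `q x - p` of the rational number `r = p / q` in lowest terms, `q > 0`. -/
noncomputable def approxErr (x : ℝ) (r : ℚ) : ℝ := (r.den : ℝ) * x - (r.num : ℝ)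

/-- The best approximations of `x` among the rational numbers of a set `Q`: the elements `p / q`
of `Q` such that `|q x - p| < |b x - a|` for all `a / b ∈ Q` other than `p / q` with `0 < b ≤ q`. -/
def bestAmong (Q : Set ℚ) (x : ℝ) : Set ℚ :=
  {r | r ∈ Q ∧ ∀ s ∈ Q, s ≠ r → s.den ≤ r.den → |approxErr x r| < |approxErr x s|}

/-- The set of best approximations of `x`. -/
def bestApprox (x : ℝ) : Set ℚ := bestAmong Set.univ x

/-- The set of best `(a)`-rational approximations of `x`. -/
def bestApproxOne (a : Letter) (x : ℝ) : Set ℚ := bestAmong (parityClass a) x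

/-- The set of best `(a, b)`-rational approximations of `x`. -/
def bestApproxTwo (a b : Letter) (x : ℝ) : Set ℚ := bestAmong (parityClass a ∪ parityClass b) x

/-- The set of best signed approximations of `x`. -/
def bestSigned (x : ℝ) : Set ℚ :=
  {r | ∀ s : ℚ, s ≠ r → s.den ≤ r.den →
    SignType.sign (approxErr x s) = SignType.sign (approxErr x r) →
      (approxErr x s < approxErr x r ∧ approxErr x r < 0) ∨
      (0 < approxErr x r ∧ approxErr x r < approxErr x s)}

/-- The reflections `H_0`, `H_1`, `H_∞`. They act by fractional linear transformations on
`OnePoint ℝ`, the boundary `ℝ ∪ {∞}` of the upper half plane (on which complex conjugation is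
trivial, so that matrices of determinant `-1` act there by `z ↦ (a z + b) / (c z + d)` too). -/
noncomputable def reflH : Letter → GL (Fin 2) ℝ
  | Letter.zero => Matrix.GeneralLinearGroup.mkOfDetNeZero !![-1, 2; 0, 1] (by simp)
  | Letter.one => Matrix.GeneralLinearGroup.mkOfDetNeZero !![-1, 0; 0, 1] (by simp)
  | Letter.inf => Matrix.GeneralLinearGroup.mkOfDetNeZero !![1, 0; 2, -1] (by simp)

/-- The intervals `I_0 = [1, ∞]`, `I_1 = [-∞, 0]` (with `-∞ = ∞`) and `I_∞ = [0, 1]` of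
`ℝ ∪ {∞}`. -/
def bdryInterval : Letter → Set (OnePoint ℝ)
  | Letter.zero => (fun t : ℝ => (t : OnePoint ℝ)) '' Set.Ici 1 ∪ {OnePoint.infty}
  | Letter.one => (fun t : ℝ => (t : OnePoint ℝ)) '' Set.Iic 0 ∪ {OnePoint.infty}
  | Letter.inf => (fun t : ℝ => (t : OnePoint ℝ)) '' Set.Icc 0 1

/-- The product `H_{α 1} H_{α 2} ⋯ H_{α m}`. -/
noncomputable def reflProd (α : ℕ → Letter) : ℕ → GL (Fin 2) ℝ
  | 0 => 1
  | m + 1 => reflProd α m * reflH (α (m + 1))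

/-- `IsDeltaExpr α y` says `y = [α 1, α 2, α 3, …]_Δ`: consecutive letters are different, and
`(H_{α 1} ⋯ H_{α (m-1)})⁻¹ · y` lies in the interval of the letter `α m` for every `m ≥ 1`.
Sequences are indexed from `1`; the value `α 0` plays no role. -/
def IsDeltaExpr (α : ℕ → Letter) (y : OnePoint ℝ) : Prop :=
  (∀ m, 1 ≤ m → α m ≠ α (m + 1)) ∧
    ∀ m, (reflProd α m)⁻¹ • y ∈ bdryInterval (α (m + 1))

/-- The sequence `α 1, …, α (m-1), α m, c, α m, c, α m, c, …`. -/
def periodicTail (α : ℕ → Letter) (m : ℕ) (c : Letter) : ℕ → Letter :=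
  fun i => if i < m then α i else if Even (i - m) then α m else c

/-- A set of rational numbers, as a set of points of `ℝ ∪ {∞}`. -/
def asBoundary (S : Set ℚ) : Set (OnePoint ℝ) := (fun r : ℚ => ((r : ℝ) : OnePoint ℝ)) '' S

/-! Both sides of each identity are read off from the Farey intervals around `x`, which start at
`⌊x⌋, ⌊x⌋ + 1` and are cut at mediants. The mediant's error is the sum of the two endpoint errors,
which have opposite signs. So the endpoint with the smaller error survives the cut and the other is
dropped. Endpoints are unimodular, so any other fraction with denominator below the mediant's has
error at least the sum of the endpoint errors in absolute value (`FareyPair.add_abs_le`). Hence best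
approximations are the survivors and best signed ones the dropped endpoints. Those of one parity
class are the dropped endpoints of that class, and those avoiding a class are the endpoints facing
one of that class (`bestApprox_eq`, `bestSigned_eq`, `bestApproxOne_eq`, `bestApproxTwo_eq`).

On the geometric side, `reflProd α m` carries the ideal triangle `0, 1, ∞` to a Farey triangle, and
a vertex label is the parity class of its image. For `m = |⌊x⌋| + 1 + t` this triangle consists of
the `t`-th Farey interval and its mediant (`IsDeltaExpr.marksEdge_fareySeq`). The letter `α m`
labels the mediant and `α (m + 1)` the dropped endpoint (`IsDeltaExpr.letter_succ`). A tail
alternating between `α m` and `c` singles out the vertex with the third label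
(`isDeltaExpr_periodicTail_iff`), so the choice of `c` selects an endpoint. -/

theorem approxErr_ne_zero {x : ℝ} (hx : Irrational x) (r : ℚ) : approxErr x r ≠ 0 := by
  intro h
  have hd : (r.den : ℝ) ≠ 0 := by exact_mod_cast r.den_nz
  apply hx
  refine ⟨r, ?_⟩
  rw [Rat.cast_def, div_eq_iff hd]
  unfold approxErr at h
  linarith

/-! ### Farey pairs and mediants -/

/-- Two rational numbers that are neighbours in the Farey graph and lie on opposite sides of `x`. -/
structure FareyPair (x : ℝ) (r s : ℚ) : Prop where
  det : (r.num * s.den - s.num * r.den) * (r.num * s.den - s.num * r.den) = 1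
  sides : approxErr x r * approxErr x s < 0

theorem FareyPair.symm {x : ℝ} {r s : ℚ} (h : FareyPair x r s) : FareyPair x s r :=
  ⟨by linear_combination h.det, by linarith [h.sides, mul_comm (approxErr x r) (approxErr x s)]⟩

/-- The Farey mediant of two rational numbers. -/
def mediant (r s : ℚ) : ℚ := ((r.num + s.num : ℤ) : ℚ) / ((r.den + s.den : ℤ) : ℚ)

theorem FareyPair.mediant_num_den {x : ℝ} {r s : ℚ} (h : FareyPair x r s) :
    (mediant r s).num = r.num + s.num ∧ ((mediant r s).den : ℤ) = r.den + s.den := by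
  have hpos : (0 : ℤ) < r.den + s.den := by have := r.den_pos; positivity
  have hco : IsCoprime (r.num + s.num) ((r.den : ℤ) + s.den) := by
    -- Bézout coefficients: the combination equals the squared determinant of the pair.
    refine ⟨(r.num * s.den - s.num * r.den) * s.den, -(r.num * s.den - s.num * r.den) * s.num, ?_⟩
    linear_combination h.det
  have hco' := Int.isCoprime_iff_nat_coprime.1 hco
  exact ⟨Rat.num_div_eq_of_coprime hpos hco', Rat.den_div_eq_of_coprime hpos hco'⟩

theorem FareyPair.mediant_den {x : ℝ} {r s : ℚ} (h : FareyPair x r s) :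
    (mediant r s).den = r.den + s.den := by
  exact_mod_cast h.mediant_num_den.2

theorem FareyPair.approxErr_mediant {x : ℝ} {r s : ℚ} (h : FareyPair x r s) :
    approxErr x (mediant r s) = approxErr x r + approxErr x s := by
  unfold approxErr
  rw [h.mediant_num_den.1, h.mediant_den]
  push_cast
  ring

/-- A sum of two errors of opposite sign takes the sign of the larger one; it is nonzero because `x`
is irrational. -/
theorem FareyPair.mediant_right {x : ℝ} (hx : Irrational x) {r s : ℚ} (h : FareyPair x r s)
    (hrs : |approxErr x r| ≤ |approxErr x s|) : FareyPair x r (mediant r s) := by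
  refine ⟨?_, ?_⟩
  · rw [h.mediant_num_den.1, h.mediant_num_den.2]
    linear_combination h.det
  · have h0 := approxErr_ne_zero hx (mediant r s)
    have h1 := h.sides
    rw [h.approxErr_mediant] at h0 ⊢
    rcases mul_neg_iff.1 h1 with ⟨hr, hs⟩ | ⟨hr, hs⟩
    · rw [abs_of_pos hr, abs_of_neg hs] at hrs
      have : approxErr x r + approxErr x s < 0 := lt_of_le_of_ne (by linarith) h0
      exact mul_neg_of_pos_of_neg hr this
    · rw [abs_of_neg hr, abs_of_pos hs] at hrs
      have : 0 < approxErr x r + approxErr x s := lt_of_le_of_ne (by linarith) h0.symm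
      exact mul_neg_of_neg_of_pos hr this

theorem abs_add_of_opposite {a b : ℝ} (h : a * b < 0) (hab : |a| ≤ |b|) : |a + b| = |b| - |a| := by
  rcases mul_neg_iff.1 h with ⟨ha, hb⟩ | ⟨ha, hb⟩
  · rw [abs_of_pos ha, abs_of_neg hb] at *
    rw [abs_of_nonpos (by linarith)]; ring
  · rw [abs_of_neg ha, abs_of_pos hb] at *
    rw [abs_of_nonneg (by linarith)]; ring

/-- A rational number other than the members of a Farey pair, with denominator less than that of
their mediant, has error at least the sum of the errors of the pair. -/
theorem FareyPair.add_abs_le {x : ℝ} {r s : ℚ} (h : FareyPair x r s) {u : ℚ} (hur : u ≠ r)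
    (hus : u ≠ s) (hu : u.den < r.den + s.den) :
    |approxErr x r| + |approxErr x s| ≤ |approxErr x u| := by
  set D : ℤ := r.num * s.den - s.num * r.den with hD
  -- Cramer's rule: `l`, `k` are the coordinates of `u` in the basis `r`, `s` of the integer
  -- lattice, as `D` is its own inverse.
  set l : ℤ := D * (u.num * s.den - s.num * u.den) with hl
  set k : ℤ := D * (r.num * u.den - u.num * r.den) with hk
  have hdet : D * D = 1 := h.det
  have hnum : u.num = l * r.num + k * s.num := by
    rw [hl, hk]; linear_combination (-u.num) * hdet + D * u.num * hD
  have hden : (u.den : ℤ) = l * r.den + k * s.den := by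
    rw [hl, hk]; linear_combination (-(u.den : ℤ)) * hdet + D * u.den * hD
  have hD0 : D ≠ 0 := by rintro h0; rw [h0] at hdet; norm_num at hdet
  have ru : (u.den : ℤ) ≠ 0 := by exact_mod_cast u.den_nz
  have hl0 : l ≠ 0 := by
    intro h0
    have : u.num * s.den - s.num * u.den = 0 := (mul_eq_zero.1 h0).resolve_left hD0
    exact hus ((Rat.eq_iff_mul_eq_mul).2 (by linarith))
  have hk0 : k ≠ 0 := by
    intro h0
    have : r.num * u.den - u.num * r.den = 0 := (mul_eq_zero.1 h0).resolve_left hD0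
    exact hur ((Rat.eq_iff_mul_eq_mul).2 (by linarith))
  have hr : (0 : ℤ) < r.den := by exact_mod_cast r.den_pos
  have hs : (0 : ℤ) < s.den := by exact_mod_cast s.den_pos
  have hup : (0 : ℤ) < u.den := by exact_mod_cast u.den_pos
  have hu' : (u.den : ℤ) < r.den + s.den := by exact_mod_cast hu
  have herr : approxErr x u = l * approxErr x r + k * approxErr x s := by
    unfold approxErr
    have h1 : (u.num : ℝ) = l * r.num + k * s.num := by exact_mod_cast hnum
    have h2 : (u.den : ℝ) = l * r.den + k * s.den := by exact_mod_cast hden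
    rw [h1, h2]; ring
  -- Coordinates of equal sign would make the denominator negative or at least `r.den + s.den`.
  have hsgn : (1 ≤ l ∧ k ≤ -1) ∨ (l ≤ -1 ∧ 1 ≤ k) := by
    rcases lt_or_gt_of_ne hl0 with hl1 | hl1 <;> rcases lt_or_gt_of_ne hk0 with hk1 | hk1
    · nlinarith
    · right; omega
    · left; omega
    · nlinarith
  -- Coefficients and errors both have opposite signs, so the two terms add without cancellation.
  have key : ∀ a b c d : ℝ, 1 ≤ a → b ≤ -1 → c * d < 0 → |c| + |d| ≤ |a * c + b * d| := by
    intro a b c d ha hb hcd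
    rcases mul_neg_iff.1 hcd with ⟨hc, hd⟩ | ⟨hc, hd⟩
    · rw [abs_of_pos hc, abs_of_neg hd]
      exact le_trans (by nlinarith) (le_abs_self _)
    · rw [abs_of_neg hc, abs_of_pos hd]
      exact le_trans (by nlinarith) (neg_le_abs _)
  rw [herr]
  rcases hsgn with ⟨h1, h2⟩ | ⟨h1, h2⟩
  · exact key _ _ _ _ (by exact_mod_cast h1) (by exact_mod_cast h2) h.sides
  · rw [add_comm, add_comm ((l : ℝ) * _)]
    exact key _ _ _ _ (by exact_mod_cast h2) (by exact_mod_cast h1) h.symm.sides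

/-! ### The Farey intervals around `x` -/

/-- The member of a pair that is closer to `x` in the sense of best approximation. -/
noncomputable def survivor (x : ℝ) (P : ℚ × ℚ) : ℚ :=
  if |approxErr x P.1| ≤ |approxErr x P.2| then P.1 else P.2

/-- The other member of a pair. -/
noncomputable def dropped (x : ℝ) (P : ℚ × ℚ) : ℚ :=
  if |approxErr x P.1| ≤ |approxErr x P.2| then P.2 else P.1

theorem survivor_dropped (x : ℝ) (P : ℚ × ℚ) :
    (survivor x P = P.1 ∧ dropped x P = P.2 ∧ |approxErr x P.1| ≤ |approxErr x P.2|) ∨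
    (survivor x P = P.2 ∧ dropped x P = P.1 ∧ |approxErr x P.2| ≤ |approxErr x P.1|) := by
  unfold survivor dropped
  split_ifs with h
  · exact Or.inl ⟨rfl, rfl, h⟩
  · exact Or.inr ⟨rfl, rfl, (not_le.1 h).le⟩

/-- The Farey intervals around `x`, starting from `⌊x⌋, ⌊x⌋ + 1`: each is the half containing `x`
of the one before it, cut at the mediant. -/
noncomputable def fareySeq (x : ℝ) : ℕ → ℚ × ℚ
  | 0 => (((⌊x⌋ : ℤ) : ℚ), ((⌊x⌋ + 1 : ℤ) : ℚ))
  | t + 1 => (survivor x (fareySeq x t), mediant (survivor x (fareySeq x t))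
      (dropped x (fareySeq x t)))

section
variable {x : ℝ} (hx : Irrational x)
include hx

theorem floor_fareyPair : FareyPair x ((⌊x⌋ : ℤ) : ℚ) ((⌊x⌋ + 1 : ℤ) : ℚ) := by
  have h1 : (⌊x⌋ : ℝ) ≠ x := fun h => hx ⟨⌊x⌋, by simpa using h⟩
  have h2 : (⌊x⌋ : ℝ) < x := lt_of_le_of_ne (Int.floor_le x) h1
  have h3 := Int.lt_floor_add_one x
  refine ⟨by simp only [Rat.num_intCast, Rat.den_intCast]; push_cast; ring, ?_⟩
  simp only [approxErr, Rat.num_intCast, Rat.den_intCast]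
  push_cast
  exact mul_neg_of_pos_of_neg (by linarith) (by linarith)

/-- Ties are impossible: equal absolute errors of opposite sign would give the mediant error zero.
-/
theorem FareyPair.survivor_dropped {P : ℚ × ℚ} (h : FareyPair x P.1 P.2) :
    FareyPair x (survivor x P) (dropped x P) ∧
      |approxErr x (survivor x P)| < |approxErr x (dropped x P)| := by
  have ha : FareyPair x (survivor x P) (dropped x P) ∧
      |approxErr x (survivor x P)| ≤ |approxErr x (dropped x P)| := by
    rcases _root_.survivor_dropped x P with ⟨h1, h2, h3⟩ | ⟨h1, h2, h3⟩
    · rw [h1, h2]; exact ⟨h, h3⟩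
    · rw [h1, h2]; exact ⟨h.symm, h3⟩
  refine ⟨ha.1, lt_of_le_of_ne ha.2 fun h0 => ?_⟩
  have h1 := abs_add_of_opposite ha.1.sides ha.2
  rw [← ha.1.approxErr_mediant, h0, sub_self, abs_eq_zero] at h1
  exact approxErr_ne_zero hx _ h1

theorem fareyPair_fareySeq (t : ℕ) : FareyPair x (fareySeq x t).1 (fareySeq x t).2 := by
  induction t with
  | zero => exact floor_fareyPair hx
  | succ t ih =>
    have h2 := ih.survivor_dropped hx
    exact h2.1.mediant_right hx h2.2.le

theorem fareyPair_survivor_dropped (t : ℕ) :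
    FareyPair x (survivor x (fareySeq x t)) (dropped x (fareySeq x t)) :=
  ((fareyPair_fareySeq hx t).survivor_dropped hx).1

theorem abs_survivor_lt_abs_dropped (t : ℕ) :
    |approxErr x (survivor x (fareySeq x t))| < |approxErr x (dropped x (fareySeq x t))| :=
  ((fareyPair_fareySeq hx t).survivor_dropped hx).2

omit hx in
theorem survivor_dropped_succ (t : ℕ) :
    (survivor x (fareySeq x (t + 1)) = survivor x (fareySeq x t) ∧
      dropped x (fareySeq x (t + 1)) =
        mediant (survivor x (fareySeq x t)) (dropped x (fareySeq x t))) ∨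
    (survivor x (fareySeq x (t + 1)) =
        mediant (survivor x (fareySeq x t)) (dropped x (fareySeq x t)) ∧
      dropped x (fareySeq x (t + 1)) = survivor x (fareySeq x t)) := by
  rcases survivor_dropped x (fareySeq x (t + 1)) with ⟨h1, h2, _⟩ | ⟨h1, h2, _⟩
  · exact Or.inl ⟨h1, h2⟩
  · exact Or.inr ⟨h1, h2⟩

/-- One step of the subtractive Euclidean algorithm on the errors. -/
theorem abs_dropped_eq_add (t : ℕ) :
    |approxErr x (dropped x (fareySeq x t))| =
      |approxErr x (survivor x (fareySeq x t))| +
        |approxErr x (mediant (survivor x (fareySeq x t)) (dropped x (fareySeq x t)))| := by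
  have h := fareyPair_survivor_dropped hx t
  rw [h.approxErr_mediant, abs_add_of_opposite h.sides (abs_survivor_lt_abs_dropped hx t).le]
  ring

theorem lt_den_add_den (t : ℕ) :
    t < (survivor x (fareySeq x t)).den + (dropped x (fareySeq x t)).den := by
  induction t with
  | zero => have := (survivor x (fareySeq x 0)).den_pos; omega
  | succ t ih =>
    have h := (fareyPair_survivor_dropped hx t).mediant_den
    have := (survivor x (fareySeq x t)).den_pos
    rcases survivor_dropped_succ (x := x) t with ⟨h1, h2⟩ | ⟨h1, h2⟩ <;> rw [h1, h2, h] <;> omega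

/-- The first Farey interval whose mediant has denominator larger than `b`. -/
theorem exists_stage {b : ℕ} (hb : 1 ≤ b) :
    ∃ t, (survivor x (fareySeq x t)).den ≤ b ∧ (dropped x (fareySeq x t)).den ≤ b ∧
      b < (survivor x (fareySeq x t)).den + (dropped x (fareySeq x t)).den := by
  classical
  have hex : ∃ t, b < (survivor x (fareySeq x t)).den + (dropped x (fareySeq x t)).den :=
    ⟨b, lt_den_add_den hx b⟩
  refine ⟨Nat.find hex, ?_⟩
  have hspec := Nat.find_spec hex
  have hmin := fun k => Nat.find_min hex (m := k)
  revert hspec hmin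
  generalize Nat.find hex = t
  intro hspec hmin
  rw [← and_assoc]
  refine ⟨?_, hspec⟩
  -- At stage `0` both denominators are `1`. Later, minimality bounds the previous mediant's
  -- denominator by `b`, and the current endpoints are that mediant and the previous survivor.
  cases t with
  | zero =>
    have h1 : (fareySeq x 0).1.den = 1 := Rat.den_intCast _
    have h2 : (fareySeq x 0).2.den = 1 := Rat.den_intCast _
    rcases survivor_dropped x (fareySeq x 0) with ⟨h3, h4, _⟩ | ⟨h3, h4, _⟩ <;>
      rw [h3, h4, h1, h2] <;> exact ⟨hb, hb⟩
  | succ t =>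
    have h := (fareyPair_survivor_dropped hx t).mediant_den
    have h0 := hmin t (Nat.lt_succ_self t)
    rcases survivor_dropped_succ (x := x) t with ⟨h1, h2⟩ | ⟨h1, h2⟩ <;> rw [h1, h2, h] <;> omega

/-- The endpoint that survives a cut does not survive for ever. -/
theorem exists_dropped_of_survivor (t : ℕ) :
    ∃ t', dropped x (fareySeq x t') = survivor x (fareySeq x t) := by
  by_contra! hne
  have hkeep : ∀ k, survivor x (fareySeq x (t + k)) = survivor x (fareySeq x t) := by
    intro k
    induction k with
    | zero => rfl
    | succ k ih =>
      rcases survivor_dropped_succ (x := x) (t + k) with ⟨h1, _⟩ | ⟨_, h2⟩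
      · exact h1.trans ih
      · exact absurd (h2.trans ih) (hne _)
  -- A permanent survivor would subtract the same `e > 0` from the dropped error at each cut,
  -- eventually making an absolute value negative.
  set e := |approxErr x (survivor x (fareySeq x t))| with he
  have hpos : 0 < e := abs_pos.2 (approxErr_ne_zero hx _)
  have hdec : ∀ k : ℕ, |approxErr x (dropped x (fareySeq x (t + k)))| =
      |approxErr x (dropped x (fareySeq x t))| - k * e := by
    intro k
    induction k with
    | zero => simp
    | succ k ih =>
      have h3 := abs_dropped_eq_add hx (t + k)
      rcases survivor_dropped_succ (x := x) (t + k) with ⟨_, h1⟩ | ⟨_, h2⟩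
      · rw [hkeep, ih] at h3
        rw [← add_assoc, h1, hkeep]
        push_cast
        linarith
      · exact absurd (h2.trans (hkeep k)) (hne _)
  obtain ⟨k, hk⟩ := exists_nat_gt (|approxErr x (dropped x (fareySeq x t))| / e)
  rw [div_lt_iff₀ hpos] at hk
  have h4 := hdec k
  have h5 := abs_nonneg (approxErr x (dropped x (fareySeq x (t + k))))
  linarith

end

/-! ### Parity classes, and minimality in a Farey pair -/

open Classical in
/-- The parity class of a rational number. -/
noncomputable def letterOf (r : ℚ) : Letter :=
  if Even r.num then Letter.zero else if Even r.den then Letter.inf else Letter.one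

theorem mem_parityClass {r : ℚ} {a : Letter} : r ∈ parityClass a ↔ letterOf r = a := by
  have hco : ¬ (Even r.num ∧ Even r.den) := by
    rintro ⟨h1, h2⟩
    have h := r.reduced
    have h3 : 2 ∣ r.num.natAbs := Int.natCast_dvd.1 h1.two_dvd
    have := Nat.dvd_gcd h3 h2.two_dvd
    rw [h] at this
    omega
  unfold letterOf
  by_cases h1 : Even r.num <;> by_cases h2 : Even r.den <;> cases a <;>
    simp_all [parityClass, ← Int.not_even_iff_odd, ← Nat.not_even_iff_odd]

/-- Fractions of one class agree modulo `2`, which makes their determinant even. -/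
theorem letterOf_ne_of_det {r s : ℚ}
    (h : (r.num * s.den - s.num * r.den) * (r.num * s.den - s.num * r.den) = 1) :
    letterOf r ≠ letterOf s := by
  intro hrs
  have h1 : s ∈ parityClass (letterOf r) := mem_parityClass.2 hrs.symm
  have h2 : r ∈ parityClass (letterOf r) := mem_parityClass.2 rfl
  have h4 : Even ((r.num * s.den - s.num * r.den) * (r.num * s.den - s.num * r.den)) := by
    revert h1 h2
    cases letterOf r <;>
      simp [parityClass, ← Int.not_even_iff_odd, ← Nat.not_even_iff_odd, Int.even_mul,
        Int.even_sub] <;> tauto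
  rw [h] at h4
  norm_num at h4

theorem FareyPair.letterOf_ne {x : ℝ} {r s : ℚ} (h : FareyPair x r s) :
    letterOf r ≠ letterOf s := letterOf_ne_of_det h.det

/-- With `FareyPair.letterOf_ne`, this gives a Farey triangle exactly one vertex of each class. -/
theorem FareyPair.letterOf_mediant {x : ℝ} {r s : ℚ} (h : FareyPair x r s) :
    letterOf (mediant r s) ≠ letterOf r ∧ letterOf (mediant r s) ≠ letterOf s := by
  constructor <;> refine letterOf_ne_of_det ?_ <;>
    rw [h.mediant_num_den.1, h.mediant_num_den.2] <;> linear_combination h.det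

theorem letter_cover {a b c : Letter} (hab : a ≠ b) (hac : a ≠ c) (hbc : b ≠ c) (d : Letter) :
    d = a ∨ d = b ∨ d = c := by
  cases a <;> cases b <;> cases c <;> cases d <;> simp_all

theorem FareyPair.eq_or_le {x : ℝ} {r s : ℚ} (h : FareyPair x r s) {u : ℚ}
    (hu : u.den < r.den + s.den) :
    u = r ∨ u = s ∨ |approxErr x r| + |approxErr x s| ≤ |approxErr x u| := by
  by_cases h1 : u = r
  · exact Or.inl h1
  by_cases h2 : u = s
  · exact Or.inr (Or.inl h2)
  exact Or.inr (Or.inr (h.add_abs_le h1 h2 hu))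

/-- A member of a Farey pair is a best approximation in any set without the other one. -/
theorem FareyPair.mem_bestAmong {x : ℝ} {r s : ℚ} (h : FareyPair x r s) {Q : Set ℚ} (hr : r ∈ Q)
    (hs : s ∉ Q ∨ |approxErr x r| < |approxErr x s|) : r ∈ bestAmong Q x := by
  refine ⟨hr, fun u hu hne hden => ?_⟩
  have hs0 := s.den_pos
  rcases h.eq_or_le (u := u) (by omega) with h1 | h1 | h1
  · exact absurd h1 hne
  · rcases hs with hs | hs
    · exact absurd (h1 ▸ hu) hs
    · rwa [h1]
  · have h2 : approxErr x s ≠ 0 := by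
      intro h0
      have := h.sides
      rw [h0, mul_zero] at this
      exact lt_irrefl _ this
    have := abs_pos.2 h2
    linarith

/-- Otherwise `r` would beat `u`. Only `r` has to lie in `Q`, which is what makes this usable for
parity classes. -/
theorem FareyPair.eq_of_mem_bestAmong {x : ℝ} {r s : ℚ} (h : FareyPair x r s) {Q : Set ℚ} {u : ℚ}
    (hu : u ∈ bestAmong Q x) (hr : r ∈ Q) (hru : r.den ≤ u.den) (hlt : u.den < r.den + s.den) :
    u = r ∨ u = s := by
  rcases h.eq_or_le hlt with h1 | h1 | h1
  · exact Or.inl h1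
  · exact Or.inr h1
  · by_cases h2 : r = u
    · exact Or.inl h2.symm
    · have := hu.2 r hr h2 hru
      have := abs_nonneg (approxErr x s)
      linarith

/-! ### The four kinds of best approximations as Farey endpoints -/

section
variable {x : ℝ} (hx : Irrational x)
include hx

theorem bestApprox_eq : bestApprox x = {r | ∃ t, r = survivor x (fareySeq x t)} := by
  ext u
  constructor
  · intro hu
    obtain ⟨t, h1, h2, h3⟩ := exists_stage hx (Nat.succ_le_of_lt u.den_pos)
    have h := fareyPair_survivor_dropped hx t
    refine ⟨t, (h.eq_of_mem_bestAmong hu (Set.mem_univ _) h1 h3).resolve_right fun h4 => ?_⟩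
    have h5 := hu.2 _ (Set.mem_univ _) (fun h0 => h.letterOf_ne (by rw [h0, h4])) h1
    have h6 := abs_survivor_lt_abs_dropped hx t
    rw [h4] at h5
    exact lt_asymm h5 h6
  · rintro ⟨t, rfl⟩
    exact (fareyPair_survivor_dropped hx t).mem_bestAmong (Set.mem_univ _)
      (Or.inr (abs_survivor_lt_abs_dropped hx t))

/-- Every survivor is dropped at some stage, so dropped endpoints alone already exhaust all
endpoints. -/
theorem exists_eq_dropped {u : ℚ} {t : ℕ}
    (h : u = survivor x (fareySeq x t) ∨ u = dropped x (fareySeq x t)) :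
    ∃ t', u = dropped x (fareySeq x t') := by
  rcases h with h | h
  · obtain ⟨t', h'⟩ := exists_dropped_of_survivor hx t
    exact ⟨t', h.trans h'.symm⟩
  · exact ⟨t, h⟩

omit hx in
theorem sign_eq_iff_mul_pos {a b : ℝ} (hb : b ≠ 0) :
    SignType.sign a = SignType.sign b ↔ 0 < a * b := by
  rcases lt_or_gt_of_ne hb with hb | hb
  · rw [sign_neg hb, sign_eq_neg_one_iff, mul_pos_iff]
    constructor
    · intro h; exact Or.inr ⟨h, hb⟩
    · rintro (h | h)
      · linarith
      · exact h.1
  · rw [sign_pos hb, sign_eq_one_iff, mul_pos_iff]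
    constructor
    · intro h; exact Or.inl ⟨h, hb⟩
    · rintro (h | h)
      · exact h.1
      · linarith

omit hx in
theorem between_iff_abs_lt {a b : ℝ} (h : 0 < a * b) :
    (a < b ∧ b < 0) ∨ (0 < b ∧ b < a) ↔ |b| < |a| := by
  rcases mul_pos_iff.1 h with ⟨ha, hb⟩ | ⟨ha, hb⟩
  · rw [abs_of_pos ha, abs_of_pos hb]
    constructor
    · rintro (h | h) <;> linarith
    · exact fun h => Or.inr ⟨hb, h⟩
  · rw [abs_of_neg ha, abs_of_neg hb]
    constructor
    · rintro (h | h) <;> linarith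
    · exact fun h => Or.inl ⟨by linarith, hb⟩

theorem mem_bestSigned_iff {r : ℚ} : r ∈ bestSigned x ↔ ∀ s : ℚ, s ≠ r → s.den ≤ r.den →
    0 < approxErr x s * approxErr x r → |approxErr x r| < |approxErr x s| := by
  unfold bestSigned
  rw [Set.mem_ofPred_eq]
  refine forall_congr' fun s => ?_
  rw [sign_eq_iff_mul_pos (approxErr_ne_zero hx r)]
  constructor
  · exact fun h h1 h2 h3 => (between_iff_abs_lt h3).1 (h h1 h2 h3)
  · exact fun h h1 h2 h3 => (between_iff_abs_lt h3).2 (h h1 h2 h3)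

/-- The other endpoint lies across `x` and does not compete; every further rival has too large an
error. -/
theorem FareyPair.mem_bestSigned {r s : ℚ} (h : FareyPair x r s) : r ∈ bestSigned x := by
  rw [mem_bestSigned_iff hx]
  intro u hne hden hsgn
  have hs0 := s.den_pos
  rcases h.eq_or_le (u := u) (by omega) with h1 | h1 | h1
  · exact absurd h1 hne
  · rw [h1] at hsgn
    exact absurd h.symm.sides (not_lt.2 hsgn.le)
  · have := abs_pos.2 (approxErr_ne_zero hx s)
    linarith

/-- Whichever endpoint lies on the same side of `x` as `u` would beat it. -/
theorem FareyPair.eq_of_mem_bestSigned {r s u : ℚ} (h : FareyPair x r s) (hu : u ∈ bestSigned x)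
    (hru : r.den ≤ u.den) (hsu : s.den ≤ u.den) (hlt : u.den < r.den + s.den) :
    u = r ∨ u = s := by
  rw [mem_bestSigned_iff hx] at hu
  rcases h.eq_or_le hlt with h1 | h1 | h1
  · exact Or.inl h1
  · exact Or.inr h1
  · by_cases h2 : r = u
    · exact Or.inl h2.symm
    by_cases h3 : s = u
    · exact Or.inr h3.symm
    have hr := abs_nonneg (approxErr x r)
    have hs := abs_nonneg (approxErr x s)
    have h4 : 0 < approxErr x r * approxErr x u ∨ 0 < approxErr x s * approxErr x u := by
      have h5 := h.sides
      have h6 := approxErr_ne_zero hx u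
      rcases mul_neg_iff.1 h5 with ⟨ha, hb⟩ | ⟨ha, hb⟩ <;> rcases lt_or_gt_of_ne h6 with hc | hc
      · exact Or.inr (mul_pos_of_neg_of_neg hb hc)
      · exact Or.inl (mul_pos ha hc)
      · exact Or.inl (mul_pos_of_neg_of_neg ha hc)
      · exact Or.inr (mul_pos hb hc)
    rcases h4 with h4 | h4
    · have := hu r h2 hru h4; linarith
    · have := hu s h3 hsu h4; linarith

theorem bestSigned_eq : bestSigned x = {r | ∃ t, r = dropped x (fareySeq x t)} := by
  ext u
  constructor
  · intro hu
    obtain ⟨t, h1, h2, h3⟩ := exists_stage hx (Nat.succ_le_of_lt u.den_pos)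
    exact exists_eq_dropped hx
      ((fareyPair_survivor_dropped hx t).eq_of_mem_bestSigned hx hu h1 h2 h3)
  · rintro ⟨t, rfl⟩
    exact (fareyPair_survivor_dropped hx t).symm.mem_bestSigned hx

theorem bestApproxOne_eq (a : Letter) :
    bestApproxOne a x = {r | ∃ t, letterOf r = a ∧ r = dropped x (fareySeq x t)} := by
  ext u
  constructor
  · intro hu
    have hua : letterOf u = a := mem_parityClass.1 hu.1
    suffices h : ∃ t, u = dropped x (fareySeq x t) by
      obtain ⟨t, ht⟩ := h
      exact ⟨t, hua, ht⟩
    obtain ⟨t, h1, h2, h3⟩ := exists_stage hx (Nat.succ_le_of_lt u.den_pos)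
    have h := fareyPair_survivor_dropped hx t
    by_cases ha : letterOf (survivor x (fareySeq x t)) = a
    · exact exists_eq_dropped hx (h.eq_of_mem_bestAmong hu (mem_parityClass.2 ha) h1 h3)
    by_cases ha' : letterOf (dropped x (fareySeq x t)) = a
    · exact exists_eq_dropped hx
        (h.symm.eq_of_mem_bestAmong hu (mem_parityClass.2 ha') h2 (by omega)).symm
    rcases h.eq_or_le h3 with h4 | h4 | h4
    · exact absurd (h4 ▸ hua) ha
    · exact absurd (h4 ▸ hua) ha'
    -- Neither endpoint has class `a`. At stage `0` the missing class is `∞`, which contains no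
    -- integer. Later, it is the class of the endpoint dropped just before: its error is the sum of
    -- the current ones, and its denominator is below that of the mediant replacing it, so it beats
    -- `u`.
    cases t with
    | zero =>
      have hd1 : (fareySeq x 0).1.den = 1 := Rat.den_intCast _
      have hd2 : (fareySeq x 0).2.den = 1 := Rat.den_intCast _
      have hd : (survivor x (fareySeq x 0)).den = 1 ∧ (dropped x (fareySeq x 0)).den = 1 := by
        rcases survivor_dropped x (fareySeq x 0) with ⟨h5, h6, _⟩ | ⟨h5, h6, _⟩ <;>
          rw [h5, h6] <;> exact ⟨by assumption, by assumption⟩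
      have hu1 : u.den = 1 := by have := u.den_pos; omega
      have hk : ∀ r : ℚ, r.den = 1 → letterOf r ≠ Letter.inf := by
        intro r hr hr'
        have h5 := (mem_parityClass.2 hr').2
        rw [hr] at h5
        exact Nat.not_even_one h5
      have h5 := h.letterOf_ne
      have h6 := hk _ hd.1
      have h7 := hk _ hd.2
      rcases letter_cover h5 h6 h7 a with h8 | h8 | h8
      · exact absurd h8.symm ha
      · exact absurd h8.symm ha'
      · exact absurd (hua.trans h8) (hk u hu1)
    | succ t =>
      refine ⟨t, ?_⟩
      have hp := fareyPair_survivor_dropped hx t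
      have hm := hp.letterOf_mediant
      have hmd := hp.mediant_den
      have herr := abs_dropped_eq_add hx t
      have h5 : letterOf (dropped x (fareySeq x t)) = a := by
        rcases letter_cover hp.letterOf_ne hm.1.symm hm.2.symm a with h5 | h5 | h5 <;>
          rcases survivor_dropped_succ (x := x) t with ⟨h6, h7⟩ | ⟨h6, h7⟩ <;>
          rw [h6] at ha <;> rw [h7] at ha' <;> tauto
      have h6 : |approxErr x (dropped x (fareySeq x t))| ≤ |approxErr x u| := by
        rcases survivor_dropped_succ (x := x) t with ⟨h6, h7⟩ | ⟨h6, h7⟩ <;>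
          rw [h6, h7] at h4 <;> linarith
      by_contra hne
      have h7 : (dropped x (fareySeq x t)).den ≤ u.den := by
        rcases survivor_dropped_succ (x := x) t with ⟨h7, h8⟩ | ⟨h7, h8⟩ <;>
          first | (rw [h7, hmd] at h1; omega) | (rw [h8, hmd] at h2; omega)
      exact absurd h6 (not_le.2 (hu.2 _ (mem_parityClass.2 h5) (Ne.symm hne) h7))
  · rintro ⟨t, ha, rfl⟩
    have h := fareyPair_survivor_dropped hx t
    refine h.symm.mem_bestAmong (mem_parityClass.2 ha) (Or.inl fun h1 => ?_)
    exact h.letterOf_ne ((mem_parityClass.1 h1).trans ha.symm)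

/-- An endpoint facing one of class `c` has lost its only close rival, since class `c` is excluded.
-/
theorem bestApproxTwo_eq {a b c : Letter} (hab : a ≠ b) (hac : a ≠ c) (hbc : b ≠ c) :
    bestApproxTwo a b x = {r | ∃ t,
      (r = survivor x (fareySeq x t) ∧ letterOf (dropped x (fareySeq x t)) = c) ∨
      (r = dropped x (fareySeq x t) ∧ letterOf (survivor x (fareySeq x t)) = c)} := by
  have hQ : ∀ r : ℚ, r ∈ parityClass a ∪ parityClass b ↔ letterOf r ≠ c := by
    intro r
    rw [Set.mem_union, mem_parityClass, mem_parityClass]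
    constructor
    · rintro (h | h) <;> rw [h] <;> assumption
    · intro h
      rcases letter_cover hab hac hbc (letterOf r) with h1 | h1 | h1
      · exact Or.inl h1
      · exact Or.inr h1
      · exact absurd h1 h
  ext u
  constructor
  · intro hu
    have huc : letterOf u ≠ c := (hQ u).1 hu.1
    obtain ⟨t, h1, h2, h3⟩ := exists_stage hx (Nat.succ_le_of_lt u.den_pos)
    have h := fareyPair_survivor_dropped hx t
    by_cases hs : letterOf (survivor x (fareySeq x t)) = c
    · have hd : letterOf (dropped x (fareySeq x t)) ≠ c := fun h0 =>
        h.letterOf_ne (hs.trans h0.symm)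
      refine ⟨t, Or.inr ⟨?_, hs⟩⟩
      exact (h.symm.eq_of_mem_bestAmong hu ((hQ _).2 hd) h2 (by omega)).resolve_right
        fun h0 => huc (h0 ▸ hs)
    have hor := h.eq_of_mem_bestAmong hu ((hQ _).2 hs) h1 h3
    by_cases hd : letterOf (dropped x (fareySeq x t)) = c
    · exact ⟨t, Or.inl ⟨hor.resolve_right fun h0 => huc (h0 ▸ hd), hd⟩⟩
    have hus : u = survivor x (fareySeq x t) := by
      refine hor.resolve_right fun h4 => ?_
      have h5 := hu.2 _ ((hQ _).2 hs) (fun h0 => h.letterOf_ne (by rw [h0, h4])) h1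
      rw [h4] at h5
      exact lt_asymm h5 (abs_survivor_lt_abs_dropped hx t)
    have hm := h.letterOf_mediant
    have hmc : letterOf (mediant (survivor x (fareySeq x t)) (dropped x (fareySeq x t))) = c := by
      rcases letter_cover h.letterOf_ne hm.1.symm hm.2.symm c with h5 | h5 | h5
      · exact absurd h5.symm hs
      · exact absurd h5.symm hd
      · exact h5.symm
    -- With no endpoint of class `c`, the mediant has that class, and it faces `u` at the next
    -- stage.
    refine ⟨t + 1, ?_⟩
    rcases survivor_dropped_succ (x := x) t with ⟨h6, h7⟩ | ⟨h6, h7⟩ <;> rw [h6, h7]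
    · exact Or.inl ⟨hus, hmc⟩
    · exact Or.inr ⟨hus, hmc⟩
  · rintro ⟨t, ⟨rfl, hc⟩ | ⟨rfl, hc⟩⟩
    · have h := fareyPair_survivor_dropped hx t
      exact h.mem_bestAmong ((hQ _).2 fun h0 => h.letterOf_ne (h0.trans hc.symm))
        (Or.inl fun h1 => (hQ _).1 h1 hc)
    · have h := (fareyPair_survivor_dropped hx t).symm
      exact h.mem_bestAmong ((hQ _).2 fun h0 => h.letterOf_ne (h0.trans hc.symm))
        (Or.inl fun h1 => (hQ _).1 h1 hc)

end

/-! ### Homogeneous coordinates and the three reflections -/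

open Matrix

/-- The point of `ℝ ∪ {∞}` with homogeneous coordinates `v`. -/
noncomputable def pointOf (v : Fin 2 → ℝ) : OnePoint ℝ :=
  if v 1 = 0 then OnePoint.infty else ((v 0 / v 1 : ℝ) : OnePoint ℝ)

theorem fin_two_ne_zero_iff {v : Fin 2 → ℝ} : v ≠ 0 ↔ v 0 ≠ 0 ∨ v 1 ≠ 0 := by
  rw [Ne, funext_iff, Fin.forall_fin_two, not_and_or]
  rfl

theorem mulVec_ne_zero (g : GL (Fin 2) ℝ) {v : Fin 2 → ℝ} (hv : v ≠ 0) :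
    (g : Matrix (Fin 2) (Fin 2) ℝ) *ᵥ v ≠ 0 := by
  intro h
  apply hv
  have h1 : ((g⁻¹ : GL (Fin 2) ℝ) : Matrix (Fin 2) (Fin 2) ℝ) *ᵥ
      ((g : Matrix (Fin 2) (Fin 2) ℝ) *ᵥ v) = v := by
    rw [mulVec_mulVec, ← Units.val_mul, inv_mul_cancel, Units.val_one, one_mulVec]
  rw [← h1, h, mulVec_zero]

/-- Replaces the fractional linear action, with its case distinctions at `∞`, by linear algebra. -/
theorem smul_pointOf (g : GL (Fin 2) ℝ) {v : Fin 2 → ℝ} (hv : v ≠ 0) :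
    g • pointOf v = pointOf ((g : Matrix (Fin 2) (Fin 2) ℝ) *ᵥ v) := by
  have e0 : ((g : Matrix (Fin 2) (Fin 2) ℝ) *ᵥ v) 0 = g 0 0 * v 0 + g 0 1 * v 1 := by
    simp
  have e1 : ((g : Matrix (Fin 2) (Fin 2) ℝ) *ᵥ v) 1 = g 1 0 * v 0 + g 1 1 * v 1 := by
    simp
  unfold pointOf
  rw [e0, e1]
  by_cases h : v 1 = 0
  · have h0 : v 0 ≠ 0 := (fin_two_ne_zero_iff.1 hv).resolve_right (not_not.2 h)
    rw [if_pos h, OnePoint.smul_infty_eq_ite, h]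
    by_cases h2 : g 1 0 = 0
    · simp [h2]
    · rw [if_neg h2, if_neg (by simp [h0, h2])]
      congr 1
      field_simp
      ring
  · rw [if_neg h, OnePoint.smul_some_eq_ite]
    have e2 : g 1 0 * (v 0 / v 1) + g 1 1 = (g 1 0 * v 0 + g 1 1 * v 1) / v 1 := by
      field_simp
    have e3 : g 0 0 * (v 0 / v 1) + g 0 1 = (g 0 0 * v 0 + g 0 1 * v 1) / v 1 := by
      field_simp
    rw [e2, e3]
    by_cases h2 : g 1 0 * v 0 + g 1 1 * v 1 = 0
    · simp [h2]
    · rw [if_neg (div_ne_zero h2 h), if_neg h2, ← OnePoint.some_eq_iff, div_div_div_cancel_right₀ h]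

theorem pointOf_smul {t : ℝ} (ht : t ≠ 0) (v : Fin 2 → ℝ) : pointOf (t • v) = pointOf v := by
  unfold pointOf
  simp only [Pi.smul_apply, smul_eq_mul, mul_eq_zero, ht, false_or, mul_div_mul_left _ _ ht]

theorem pointOf_coe (x : ℝ) : pointOf ![x, 1] = (x : OnePoint ℝ) := by
  simp [pointOf]

theorem exists_pointOf (y : OnePoint ℝ) : ∃ v : Fin 2 → ℝ, v ≠ 0 ∧ pointOf v = y := by
  induction y using OnePoint.rec with
  | infty => exact ⟨![1, 0], by simp, by simp [pointOf]⟩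
  | coe t => exact ⟨![t, 1], by simp, pointOf_coe t⟩

/-- The linear forms that vanish at the vertices `0`, `1`, `∞` of the ideal triangle, normalized
to have sum zero. -/
def vertexForm (v : Fin 2 → ℝ) : Letter → ℝ
  | Letter.zero => v 0
  | Letter.one => v 1 - v 0
  | Letter.inf => -v 1

/-- Homogeneous coordinates of the vertices of the ideal triangle, normalized to have sum zero. -/
def vertexVec : Letter → Fin 2 → ℝ
  | Letter.zero => ![0, 1]
  | Letter.one => ![-1, -1]
  | Letter.inf => ![1, 0]

theorem vertexVec_ne_zero (a : Letter) : vertexVec a ≠ 0 := by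
  cases a <;> simp [vertexVec]

theorem vertexForm_sum (v : Fin 2 → ℝ) {a b c : Letter} (hab : a ≠ b) (hac : a ≠ c)
    (hbc : b ≠ c) : vertexForm v a + vertexForm v b + vertexForm v c = 0 := by
  cases a <;> cases b <;> cases c <;> simp_all [vertexForm] <;> ring

theorem vertexVec_sum {a b c : Letter} (hab : a ≠ b) (hac : a ≠ c)
    (hbc : b ≠ c) : vertexVec a + vertexVec b + vertexVec c = 0 := by
  cases a <;> cases b <;> cases c <;> simp_all [vertexVec]

/-- The interval of `a` is the arc between the vertices `b` and `c` that avoids `a`; the two forms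
vanish at its ends, so their sign product decides the arc. This form is symmetric in the letters. -/
theorem pointOf_mem_bdryInterval {v : Fin 2 → ℝ} (hv : v ≠ 0) {a b c : Letter} (hab : a ≠ b)
    (hac : a ≠ c) (hbc : b ≠ c) :
    pointOf v ∈ bdryInterval a ↔ 0 ≤ vertexForm v b * vertexForm v c := by
  have h0 : pointOf v ∈ bdryInterval Letter.zero ↔ 0 ≤ (v 1 - v 0) * -v 1 := by
    unfold pointOf
    by_cases h : v 1 = 0
    · simp [bdryInterval, h]
    · have h2 : 0 < v 1 * v 1 := mul_self_pos.2 h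
      have h3 : (v 1 - v 0) * -v 1 = (v 0 / v 1 - 1) * (v 1 * v 1) := by field_simp; ring
      rw [h3, mul_nonneg_iff_of_pos_right h2]
      simp [bdryInterval, h]
  have h1 : pointOf v ∈ bdryInterval Letter.one ↔ 0 ≤ v 0 * -v 1 := by
    unfold pointOf
    by_cases h : v 1 = 0
    · simp [bdryInterval, h]
    · have h2 : 0 < v 1 * v 1 := mul_self_pos.2 h
      have h3 : v 0 * -v 1 = (-(v 0 / v 1)) * (v 1 * v 1) := by field_simp
      rw [h3, mul_nonneg_iff_of_pos_right h2]
      simp [bdryInterval, h]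
  have h4 : pointOf v ∈ bdryInterval Letter.inf ↔ 0 ≤ v 0 * (v 1 - v 0) := by
    unfold pointOf
    by_cases h : v 1 = 0
    · have h0 : v 0 ≠ 0 := (fin_two_ne_zero_iff.1 hv).resolve_right (not_not.2 h)
      simpa [bdryInterval, h] using h0
    · have h2 : 0 < v 1 * v 1 := mul_self_pos.2 h
      have h3 : v 0 * (v 1 - v 0) = (v 0 / v 1 * (1 - v 0 / v 1)) * (v 1 * v 1) := by field_simp
      rw [h3, mul_nonneg_iff_of_pos_right h2]
      simp only [bdryInterval, h, if_false, Set.mem_image, OnePoint.coe_eq_coe, exists_eq_right,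
        Set.mem_Icc]
      constructor
      · rintro ⟨h4, h5⟩
        exact mul_nonneg h4 (by linarith)
      · intro h4
        constructor <;> nlinarith
  cases a <;> cases b <;> cases c <;> simp_all [vertexForm] <;> rw [mul_comm]

theorem pointOf_eq_vertex {v : Fin 2 → ℝ} (hv : v ≠ 0) {a : Letter} :
    pointOf v = pointOf (vertexVec a) ↔ vertexForm v a = 0 := by
  have h0 := fin_two_ne_zero_iff.1 hv
  unfold pointOf
  by_cases h : v 1 = 0
  · cases a <;> simp_all [vertexVec, vertexForm]
  · cases a
    · simp [vertexVec, vertexForm, h]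
    · simp [vertexVec, vertexForm, h, div_eq_iff, sub_eq_zero, eq_comm (a := v 0)]
    · simp [vertexVec, vertexForm, h]

theorem reflH_zero_mulVec (v : Fin 2 → ℝ) :
    (reflH Letter.zero : Matrix (Fin 2) (Fin 2) ℝ) *ᵥ v = ![2 * v 1 - v 0, v 1] := by
  ext i
  fin_cases i <;>
    simp [reflH, GeneralLinearGroup.mkOfDetNeZero, mulVec, dotProduct, Fin.sum_univ_two]
  ring

theorem reflH_one_mulVec (v : Fin 2 → ℝ) :
    (reflH Letter.one : Matrix (Fin 2) (Fin 2) ℝ) *ᵥ v = ![-v 0, v 1] := by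
  ext i
  fin_cases i <;>
    simp [reflH, GeneralLinearGroup.mkOfDetNeZero, mulVec, dotProduct, Fin.sum_univ_two]

theorem reflH_inf_mulVec (v : Fin 2 → ℝ) :
    (reflH Letter.inf : Matrix (Fin 2) (Fin 2) ℝ) *ᵥ v = ![v 0, 2 * v 0 - v 1] := by
  ext i
  fin_cases i <;>
    simp [reflH, GeneralLinearGroup.mkOfDetNeZero, mulVec, dotProduct, Fin.sum_univ_two]
  ring

/-- The reflection fixes the vertices `b` and `c`, so their forms are eigenvectors; the eigenvalues
are `±1`, opposite as the determinant is `-1`. -/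
theorem vertexForm_reflH {a b c : Letter} (hab : a ≠ b) (hac : a ≠ c) (hbc : b ≠ c) :
    ∃ e : ℝ, e * e = 1 ∧ ∀ v : Fin 2 → ℝ,
      vertexForm ((reflH a : Matrix (Fin 2) (Fin 2) ℝ) *ᵥ v) b = e * vertexForm v b ∧
      vertexForm ((reflH a : Matrix (Fin 2) (Fin 2) ℝ) *ᵥ v) c = -e * vertexForm v c := by
  cases a <;> cases b <;> cases c <;> first | contradiction | skip
  all_goals
    first
    | refine ⟨1, by norm_num, fun v => ?_⟩
      simp only [vertexForm, reflH_zero_mulVec, reflH_one_mulVec, reflH_inf_mulVec, cons_val_zero,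
        cons_val_one]
      constructor <;> ring1
    | refine ⟨-1, by norm_num, fun v => ?_⟩
      simp only [vertexForm, reflH_zero_mulVec, reflH_one_mulVec, reflH_inf_mulVec, cons_val_zero,
        cons_val_one]
      constructor <;> ring1

theorem reflH_mulVec_vertexVec {a b c : Letter} (hab : a ≠ b) (hac : a ≠ c)
    (hbc : b ≠ c) : ∃ e : ℝ, e * e = 1 ∧
      (reflH a : Matrix (Fin 2) (Fin 2) ℝ) *ᵥ vertexVec b = e • vertexVec b ∧
      (reflH a : Matrix (Fin 2) (Fin 2) ℝ) *ᵥ vertexVec c = (-e) • vertexVec c := by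
  cases a <;> cases b <;> cases c <;> first | contradiction | skip
  all_goals
    first
    | refine ⟨1, by norm_num, ?_, ?_⟩ <;>
        simp only [reflH_zero_mulVec, reflH_one_mulVec, reflH_inf_mulVec] <;> ext i <;>
        fin_cases i <;> (norm_num [vertexVec]; done)
    | refine ⟨-1, by norm_num, ?_, ?_⟩ <;>
        simp only [reflH_zero_mulVec, reflH_one_mulVec, reflH_inf_mulVec] <;> ext i <;>
        fin_cases i <;> (norm_num [vertexVec]; done)

theorem reflH_mul_self (a : Letter) : reflH a * reflH a = 1 := by
  ext i j
  cases a <;> fin_cases i <;> fin_cases j <;>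
    simp [reflH, Matrix.GeneralLinearGroup.mkOfDetNeZero, Matrix.mul_apply, Fin.sum_univ_two]

theorem reflH_inv (a : Letter) : (reflH a)⁻¹ = reflH a :=
  inv_eq_of_mul_eq_one_left (reflH_mul_self a)

theorem exists_third {a b : Letter} (hab : a ≠ b) : ∃ c, a ≠ c ∧ b ≠ c := by
  by_contra! h
  have h0 := h Letter.zero
  have h1 := h Letter.one
  have h2 := h Letter.inf
  cases a <;> cases b <;> simp_all

theorem reflH_smul_vertex {a b : Letter} (hab : a ≠ b) :
    reflH a • pointOf (vertexVec b) = pointOf (vertexVec b) := by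
  obtain ⟨c, hac, hbc⟩ := exists_third hab
  obtain ⟨e, he, h1, -⟩ := reflH_mulVec_vertexVec hab hac hbc
  rw [smul_pointOf _ (vertexVec_ne_zero b), h1, pointOf_smul]
  rintro rfl
  norm_num at he

theorem vertex_mem_bdryInterval {a b : Letter} (hab : a ≠ b) :
    pointOf (vertexVec b) ∈ bdryInterval a := by
  obtain ⟨c, hac, hbc⟩ := exists_third hab
  rw [pointOf_mem_bdryInterval (vertexVec_ne_zero b) hab hac hbc,
    (pointOf_eq_vertex (vertexVec_ne_zero b)).1 rfl, zero_mul]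

/-- The reflection exchanges the arc of `a` with its complementary arc, which contains the arc of
`b`. -/
theorem reflH_smul_mem {a b : Letter} (hab : a ≠ b) {z : OnePoint ℝ} (hz : z ∈ bdryInterval b) :
    reflH a • z ∈ bdryInterval a := by
  obtain ⟨c, hac, hbc⟩ := exists_third hab
  obtain ⟨v, hv, rfl⟩ := exists_pointOf z
  obtain ⟨e, he, h1⟩ := vertexForm_reflH hab hac hbc
  rw [pointOf_mem_bdryInterval hv hab.symm hbc hac] at hz
  rw [smul_pointOf _ hv, pointOf_mem_bdryInterval (mulVec_ne_zero _ hv) hab hac hbc, (h1 v).1,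
    (h1 v).2]
  have hsum := vertexForm_sum v hab hac hbc
  have hb : vertexForm v b = -vertexForm v a - vertexForm v c := by linarith
  have h2 : e * vertexForm v b * (-e * vertexForm v c) =
      vertexForm v a * vertexForm v c + vertexForm v c * vertexForm v c := by
    rw [hb]
    linear_combination (vertexForm v a * vertexForm v c + vertexForm v c * vertexForm v c) * he
  rw [h2]
  exact add_nonneg hz (mul_self_nonneg _)

/-! ### Expansions with an alternating tail -/

theorem reflProd_succ_inv_smul (α : ℕ → Letter) (m : ℕ) (y : OnePoint ℝ) :
    (reflProd α (m + 1))⁻¹ • y = reflH (α (m + 1)) • (reflProd α m)⁻¹ • y := by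
  rw [reflProd, _root_.mul_inv_rev, mul_smul, reflH_inv]

theorem reflProd_congr {α β : ℕ → Letter} {m : ℕ} (h : ∀ i, 1 ≤ i → i ≤ m → α i = β i) :
    reflProd α m = reflProd β m := by
  induction m with
  | zero => rfl
  | succ m ih =>
    rw [reflProd, reflProd, ih fun i h1 h2 => h i h1 (by omega), h (m + 1) (by omega) le_rfl]

theorem periodicTail_of_lt {α : ℕ → Letter} {m i : ℕ} {c : Letter} (h : i < m) :
    periodicTail α m c i = α i := if_pos h

theorem periodicTail_self (α : ℕ → Letter) (m : ℕ) (c : Letter) : periodicTail α m c m = α m := by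
  simp [periodicTail]

theorem periodicTail_add (α : ℕ → Letter) (m k : ℕ) (c : Letter) :
    periodicTail α m c (m + k) = if Even k then α m else c := by
  simp [periodicTail]

theorem periodicTail_ne {α : ℕ → Letter} (hα : ∀ i, 1 ≤ i → α i ≠ α (i + 1)) {m : ℕ} {c : Letter}
    (hc : α m ≠ c) (i : ℕ) (hi : 1 ≤ i) :
    periodicTail α m c i ≠ periodicTail α m c (i + 1) := by
  rcases lt_or_ge i m with h | h
  · rw [periodicTail_of_lt h]
    rcases eq_or_lt_of_le (Nat.succ_le_of_lt h) with h2 | h2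
    · rw [show i + 1 = m from h2, periodicTail_self, ← show i + 1 = m from h2]
      exact hα i hi
    · rw [periodicTail_of_lt (show i + 1 < m from h2)]
      exact hα i hi
  · obtain ⟨k, rfl⟩ := Nat.exists_eq_add_of_le h
    rw [add_assoc, periodicTail_add, periodicTail_add]
    by_cases hk : Even k
    · rw [if_pos hk, if_neg (by simpa [Nat.even_add_one] using hk)]
      exact hc
    · rw [if_neg hk, if_pos (by simpa [Nat.even_add_one] using hk)]
      exact hc.symm

/-- A point staying in the intervals of two alternating letters is the common endpoint. -/
theorem eq_vertex_of_alternating {β : ℕ → Letter} {d : Letter} (hβ : ∀ k, β k ≠ β (k + 1))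
    (hd : ∀ k, β k ≠ d) {z : ℕ → OnePoint ℝ} (hz : ∀ k, z (k + 1) = reflH (β k) • z k)
    (hI : ∀ k, z k ∈ bdryInterval (β k)) : z 0 = pointOf (vertexVec d) := by
  obtain ⟨v, hv, hv0⟩ := exists_pointOf (z 0)
  -- Two alternating reflections compose to a parabolic map fixing the vertex `d`. In coordinates,
  -- the product that must stay nonnegative drops by the fixed square of `vertexForm v d` at each
  -- step, so that form vanishes.
  have key : ∀ k : ℕ, ∃ w, w ≠ 0 ∧ pointOf w = z k ∧
      vertexForm w d * vertexForm w d = vertexForm v d * vertexForm v d ∧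
      vertexForm w (β (k + 1)) * vertexForm w d =
        vertexForm v (β 1) * vertexForm v d - k * (vertexForm v d * vertexForm v d) := by
    intro k
    induction k with
    | zero => exact ⟨v, hv, hv0, rfl, by simp⟩
    | succ k ih =>
      obtain ⟨w, hw, hwz, h1, h2⟩ := ih
      obtain ⟨e, he, h3⟩ := vertexForm_reflH (hβ k) (hd k) (hd (k + 1))
      refine ⟨_, mulVec_ne_zero (reflH (β k)) hw, ?_, ?_, ?_⟩
      · rw [hz, ← hwz, smul_pointOf _ hw]
      · rw [(h3 w).2]
        linear_combination h1 + vertexForm w d * vertexForm w d * he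
      · have h4 : β (k + 1 + 1) = β k := by
          rcases letter_cover (hβ k) (hd k) (hd (k + 1)) (β (k + 1 + 1)) with h | h | h
          · exact h
          · exact absurd h.symm (hβ (k + 1))
          · exact absurd h (hd _)
        have h5 := vertexForm_sum ((reflH (β k) : Matrix (Fin 2) (Fin 2) ℝ) *ᵥ w) (hβ k) (hd k)
          (hd (k + 1))
        have h6 := h3 w
        rw [h4]
        push_cast
        rw [h6.1, h6.2] at h5
        have h7 : vertexForm ((reflH (β k) : Matrix (Fin 2) (Fin 2) ℝ) *ᵥ w) (β k) =
          e * (vertexForm w d - vertexForm w (β (k + 1))) := by linarith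
        rw [h7, h6.2]
        linear_combination (vertexForm w (β (k + 1)) * vertexForm w d -
          vertexForm w d * vertexForm w d) * he + h2 - h1
  rw [← hv0, pointOf_eq_vertex hv]
  by_contra hne
  have hpos : 0 < vertexForm v d * vertexForm v d := mul_self_pos.2 hne
  obtain ⟨k, hk⟩ := exists_nat_gt
    (vertexForm v (β 1) * vertexForm v d / (vertexForm v d * vertexForm v d))
  rw [div_lt_iff₀ hpos] at hk
  obtain ⟨w, hw, hwz, h1, h2⟩ := key k
  have h3 := hI k
  rw [← hwz, pointOf_mem_bdryInterval hw (hβ k) (hd k) (hd (k + 1)), h2] at h3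
  linarith

theorem isDeltaExpr_periodicTail_iff {α : ℕ → Letter} (hα : ∀ i, 1 ≤ i → α i ≠ α (i + 1)) {m : ℕ}
    (hm : 1 ≤ m) {c d : Letter} (hc : α m ≠ c) (hd : α m ≠ d) (hcd : c ≠ d) (y : OnePoint ℝ) :
    IsDeltaExpr (periodicTail α m c) y ↔ y = reflProd α m • pointOf (vertexVec d) := by
  obtain ⟨n, rfl⟩ : ∃ n, m = n + 1 := ⟨m - 1, by omega⟩
  set β := periodicTail α (n + 1) c with hβ
  have hne := periodicTail_ne hα hc
  rw [← hβ] at hne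
  have hαβ : reflProd α (n + 1) = reflProd β (n + 1) := by
    refine reflProd_congr fun i _ hi => ?_
    rcases eq_or_lt_of_le hi with h | h
    · rw [h, hβ, periodicTail_self]
    · rw [hβ, periodicTail_of_lt h]
  have hβd : ∀ k, β (n + 1 + k) ≠ d := by
    intro k
    rw [hβ, periodicTail_add]
    split_ifs <;> assumption
  have hfix : reflProd β (n + 1) • pointOf (vertexVec d) = reflProd β n • pointOf (vertexVec d) := by
    rw [reflProd, mul_smul, reflH_smul_vertex (hβd 0)]
  rw [hαβ, hfix]
  constructor
  · rintro ⟨-, h⟩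
    rw [← inv_smul_eq_iff]
    refine eq_vertex_of_alternating (β := fun k => β (n + 1 + k)) (d := d)
      (z := fun k => (reflProd β (n + k))⁻¹ • y) (fun k => hne _ (by omega)) hβd (fun k => ?_)
      (fun k => ?_)
    · have := reflProd_succ_inv_smul β (n + k) y
      rwa [show β (n + k + 1) = β (n + 1 + k) by rw [add_right_comm]] at this
    · have := h (n + k)
      rwa [add_right_comm] at this
  · rintro rfl
    refine ⟨hne, ?_⟩
    set y := reflProd β n • pointOf (vertexVec d) with hy
    have h1 : ∀ k, (reflProd β (n + k))⁻¹ • y = pointOf (vertexVec d) := by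
      intro k
      induction k with
      | zero => rw [hy, add_zero, inv_smul_smul]
      | succ k ih =>
        rw [← add_assoc, reflProd_succ_inv_smul, ih, add_right_comm, reflH_smul_vertex (hβd k)]
    -- Membership at the earlier indices is pulled back from index `n`, one reflection at a time, by
    -- `reflH_smul_mem`.
    have h2 : ∀ j k, k + j = n → (reflProd β k)⁻¹ • y ∈ bdryInterval (β (k + 1)) := by
      intro j
      induction j with
      | zero =>
        intro k hk
        have := h1 0
        rw [add_zero] at this
        rw [show k = n from hk, this]
        exact vertex_mem_bdryInterval (hβd 0)
      | succ j ih =>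
        intro k hk
        have h3 := ih (k + 1) (by omega)
        have h4 := reflH_smul_mem (hne (k + 1) (by omega)) h3
        rwa [reflProd_succ_inv_smul, ← mul_smul, reflH_mul_self, one_smul] at h4
    intro k
    rcases le_total k n with hk | hk
    · exact h2 (n - k) k (by omega)
    · obtain ⟨j, rfl⟩ := Nat.exists_eq_add_of_le hk
      rw [h1, add_right_comm]
      exact vertex_mem_bdryInterval (hβd j)

/-! ### Triangles with marked edges -/

/-- The determinant of two vectors of the plane. -/
def cross (u v : Fin 2 → ℝ) : ℝ := u 0 * v 1 - u 1 * v 0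

theorem cross_smul_right (t : ℝ) (u v : Fin 2 → ℝ) : cross u (t • v) = t * cross u v := by
  simp [cross]; ring

theorem vertexForm_eq_cross (v : Fin 2 → ℝ) (a : Letter) : vertexForm v a = cross v (vertexVec a) := by
  cases a <;> simp [vertexForm, cross, vertexVec]
  ring

theorem cross_mulVec (g : Matrix (Fin 2) (Fin 2) ℝ) (u v : Fin 2 → ℝ) :
    cross (g *ᵥ u) (g *ᵥ v) = g.det * cross u v := by
  simp only [cross, mulVec, dotProduct, Fin.sum_univ_two, det_fin_two]
  ring

/-- The matrix `g` carries the vertices `i`, `j` to the points with homogeneous coordinates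
`u`, `v`, and the third vertex to `u + v`. -/
def MarksEdge (g : GL (Fin 2) ℝ) (i j : Letter) (u v : Fin 2 → ℝ) : Prop :=
  ∃ t : ℝ, t ≠ 0 ∧ (g : Matrix (Fin 2) (Fin 2) ℝ) *ᵥ vertexVec i = t • u ∧
    (g : Matrix (Fin 2) (Fin 2) ℝ) *ᵥ vertexVec j = t • v

theorem MarksEdge.symm {g : GL (Fin 2) ℝ} {i j : Letter} {u v : Fin 2 → ℝ}
    (h : MarksEdge g i j u v) : MarksEdge g j i v u := by
  obtain ⟨t, ht, h1, h2⟩ := h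
  exact ⟨t, ht, h2, h1⟩

theorem MarksEdge.smul_vertex {g : GL (Fin 2) ℝ} {i j : Letter} {u v : Fin 2 → ℝ}
    (h : MarksEdge g i j u v) : g • pointOf (vertexVec i) = pointOf u := by
  obtain ⟨t, ht, h1, _⟩ := h
  rw [smul_pointOf _ (vertexVec_ne_zero i), h1, pointOf_smul ht]

theorem MarksEdge.third {g : GL (Fin 2) ℝ} {i j k : Letter} (hij : i ≠ j) (hik : i ≠ k)
    (hjk : j ≠ k) {u v : Fin 2 → ℝ} {t : ℝ}
    (h1 : (g : Matrix (Fin 2) (Fin 2) ℝ) *ᵥ vertexVec i = t • u)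
    (h2 : (g : Matrix (Fin 2) (Fin 2) ℝ) *ᵥ vertexVec j = t • v) :
    (g : Matrix (Fin 2) (Fin 2) ℝ) *ᵥ vertexVec k = (-t) • (u + v) := by
  have h3 : vertexVec k = -(vertexVec i + vertexVec j) :=
    eq_neg_of_add_eq_zero_right (vertexVec_sum hij hik hjk)
  rw [h3, mulVec_neg, mulVec_add, h1, h2, ← smul_add, neg_smul]

/-- Reflecting in the side opposite `j` leaves the vertices `i` and `k` in place, and `k` was
already at `u + v`. -/
theorem MarksEdge.reflH {g : GL (Fin 2) ℝ} {i j k : Letter} (hij : i ≠ j) (hik : i ≠ k)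
    (hjk : j ≠ k) {u v : Fin 2 → ℝ} (h : MarksEdge g i j u v) :
    MarksEdge (g * reflH j) i k u (u + v) := by
  obtain ⟨t, ht, h1, h2⟩ := h
  obtain ⟨e, he, h3, h4⟩ := reflH_mulVec_vertexVec hij.symm hjk hik
  have he0 : e ≠ 0 := by
    rintro rfl
    norm_num at he
  refine ⟨e * t, mul_ne_zero he0 ht, ?_, ?_⟩
  · rw [Units.val_mul, ← mulVec_mulVec, h3, mulVec_smul, h1, smul_smul]
  · rw [Units.val_mul, ← mulVec_mulVec, h4, mulVec_smul, MarksEdge.third hij hik hjk h1 h2,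
      smul_smul, neg_mul_neg]

/-- The arc of `j` is cut off by the side `i k`, so `w` lies beyond the side from `u` to `u + v`.
Pulling back by `g` scales both determinants by `g.det`; the sign flips because `k` goes to a
multiple of `-(u + v)`. -/
theorem MarksEdge.cross_mul_cross_nonpos {g : GL (Fin 2) ℝ} {i j k : Letter} (hij : i ≠ j)
    (hik : i ≠ k) (hjk : j ≠ k) {u v : Fin 2 → ℝ} (h : MarksEdge g i j u v) {w : Fin 2 → ℝ}
    (hw : w ≠ 0) (hI : g⁻¹ • pointOf w ∈ bdryInterval j) :
    cross w u * cross w (u + v) ≤ 0 := by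
  obtain ⟨t, ht, h1, h2⟩ := h
  have h3 := MarksEdge.third hij hik hjk h1 h2
  rw [smul_pointOf _ hw, pointOf_mem_bdryInterval (mulVec_ne_zero _ hw) hij.symm hjk hik,
    vertexForm_eq_cross, vertexForm_eq_cross] at hI
  set w' := ((g⁻¹ : GL (Fin 2) ℝ) : Matrix (Fin 2) (Fin 2) ℝ) *ᵥ w with hw'
  have h4 : (g : Matrix (Fin 2) (Fin 2) ℝ) *ᵥ w' = w := by
    rw [hw', mulVec_mulVec, ← Units.val_mul, mul_inv_cancel, Units.val_one, one_mulVec]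
  have h5 := cross_mulVec (g : Matrix (Fin 2) (Fin 2) ℝ) w' (vertexVec i)
  have h6 := cross_mulVec (g : Matrix (Fin 2) (Fin 2) ℝ) w' (vertexVec k)
  rw [h4, h1, cross_smul_right] at h5
  rw [h4, h3, cross_smul_right] at h6
  have h7 : (t * t) * (cross w u * cross w (u + v)) =
      -(((g : Matrix (Fin 2) (Fin 2) ℝ).det * (g : Matrix (Fin 2) (Fin 2) ℝ).det) *
        (cross w' (vertexVec i) * cross w' (vertexVec k))) := by
    linear_combination (t * cross w (u + v)) * h5 -
      ((g : Matrix (Fin 2) (Fin 2) ℝ).det * cross w' (vertexVec i)) * h6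
  have h8 : (t * t) * (cross w u * cross w (u + v)) ≤ 0 := by
    rw [h7]
    exact neg_nonpos.2 (mul_nonneg (mul_self_nonneg _) hI)
  have h9 : 0 < t * t := mul_self_pos.2 ht
  exact nonpos_of_mul_nonpos_right h8 h9

/-! ### Rational points in homogeneous coordinates -/

/-- Homogeneous coordinates of a rational number. -/
def ratVec (r : ℚ) : Fin 2 → ℝ := ![r.num, r.den]

theorem pointOf_ratVec (r : ℚ) : pointOf (ratVec r) = ((r : ℝ) : OnePoint ℝ) := by
  have : (r.den : ℝ) ≠ 0 := by exact_mod_cast r.den_nz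
  simp [pointOf, ratVec, Rat.cast_def]

theorem cross_ratVec (x : ℝ) (r : ℚ) : cross ![x, 1] (ratVec r) = approxErr x r := by
  simp [cross, ratVec, approxErr, mul_comm]

theorem FareyPair.ratVec_mediant {x : ℝ} {r s : ℚ} (h : FareyPair x r s) :
    ratVec (mediant r s) = ratVec r + ratVec s := by
  ext i
  fin_cases i
  · simp [ratVec, h.mediant_num_den.1]
  · simp [ratVec, h.mediant_den]

theorem coords_ne_zero (x : ℝ) : (![x, 1] : Fin 2 → ℝ) ≠ 0 := by simp

theorem letterOf_intCast_ne_inf (n : ℤ) : letterOf (n : ℚ) ≠ Letter.inf := by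
  intro h
  have h1 := (mem_parityClass.2 h).2
  rw [Rat.den_intCast] at h1
  exact Nat.not_even_one h1

theorem letterOf_intCast_ne {n k : ℤ} (h : (n - k) * (n - k) = 1) :
    letterOf (n : ℚ) ≠ letterOf (k : ℚ) :=
  letterOf_ne_of_det (by simpa only [Rat.num_intCast, Rat.den_intCast, Nat.cast_one, mul_one])

theorem ratVec_intCast (n : ℤ) : ratVec (n : ℚ) = ![(n : ℝ), 1] := by
  simp only [ratVec, Rat.num_intCast, Rat.den_intCast, Nat.cast_one]

/-! ### Following the expansion of `x` through the Farey triangles -/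

section
variable {x : ℝ} {α : ℕ → Letter} (hα : IsDeltaExpr α (x : OnePoint ℝ))
include hα

theorem IsDeltaExpr.cross_mul_cross_nonpos {m : ℕ} {i j k : Letter} (hij : i ≠ j)
    (hik : i ≠ k) (hjk : j ≠ k) {u v : Fin 2 → ℝ} (h : MarksEdge (reflProd α m) i j u v)
    (hj : α (m + 1) = j) : cross ![x, 1] u * cross ![x, 1] (u + v) ≤ 0 := by
  refine h.cross_mul_cross_nonpos hij hik hjk (coords_ne_zero x) ?_
  rw [pointOf_coe, ← hj]
  exact hα.2 m

/-- One step along the integers `c, c + e, c + 2 e, …` with `e = ±1`, towards `x`. -/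
theorem IsDeltaExpr.marksEdge_int_step {m : ℕ} {c d : ℤ} {e : ℝ} (he : e * e = 1)
    (hd : (d : ℝ) = c + e)
    (h : MarksEdge (reflProd α m) (letterOf (c : ℚ)) Letter.inf ![(c : ℝ), 1] ![e, 0])
    (hl : α (m + 1) ≠ letterOf (d : ℚ)) (hc : 0 < e * (x - c)) :
    (0 < e * (x - d) → α (m + 1) = letterOf (c : ℚ) ∧
      MarksEdge (reflProd α (m + 1)) (letterOf (d : ℚ)) Letter.inf ![(d : ℝ), 1] ![e, 0]) ∧
    (e * (x - d) < 0 → α (m + 1) = Letter.inf ∧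
      MarksEdge (reflProd α (m + 1)) (letterOf (c : ℚ)) (letterOf (d : ℚ)) (ratVec c)
        (ratVec d)) := by
  have hci := letterOf_intCast_ne_inf c
  have hdi := letterOf_intCast_ne_inf d
  have hcd : letterOf (c : ℚ) ≠ letterOf (d : ℚ) := by
    refine letterOf_intCast_ne ?_
    have : ((c : ℝ) - d) * (c - d) = 1 := by rw [hd]; linear_combination he
    exact_mod_cast this
  have hsum : ![(c : ℝ), 1] + ![e, 0] = ![(d : ℝ), 1] := by
    rw [hd]; ext i; fin_cases i <;> simp
  have hcr : ∀ z : ℝ, cross ![x, 1] ![z, 1] = x - z := fun z => by simp [cross]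
  have hcr' : cross ![x, 1] ![e, 0] = -e := by simp [cross]
  -- The three sides of the triangle `c, d, ∞`: the side `d ∞` leads to the next integer, the side
  -- `c ∞` is ruled out by `hl`, and the side `c d` leaves the fan at `∞`.
  rcases letter_cover hcd hci hdi (α (m + 1)) with h1 | h1 | h1
  · have h2 := hα.cross_mul_cross_nonpos hci.symm hdi.symm hcd h.symm h1
    rw [add_comm, hsum, hcr, hcr'] at h2
    refine ⟨fun _ => ⟨h1, ?_⟩, fun h3 => by linarith⟩
    rw [reflProd, h1]
    have h3 := h.symm.reflH hci.symm hdi.symm hcd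
    rw [add_comm, hsum] at h3
    exact h3.symm
  · exact absurd h1 hl
  · have h2 := hα.cross_mul_cross_nonpos hci hcd hdi.symm h h1
    rw [hsum, hcr, hcr] at h2
    refine ⟨fun h3 => ?_, fun _ => ⟨h1, ?_⟩⟩
    · have h4 := mul_pos hc h3
      have h5 : e * (x - c) * (e * (x - d)) = (x - c) * (x - d) := by
        linear_combination ((x - c) * (x - d)) * he
      linarith
    · rw [reflProd, h1, ratVec_intCast, ratVec_intCast, ← hsum]
      exact h.reflH hci hcd hdi.symm

theorem IsDeltaExpr.marksEdge_int {m : ℕ} {e : ℤ} (he : e * e = 1)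
    (h0 : MarksEdge (reflProd α m) (letterOf ((0 : ℤ) : ℚ)) Letter.inf ![((0 : ℤ) : ℝ), 1]
      ![(e : ℝ), 0])
    (hm : α (m + 1) ≠ letterOf (e : ℚ)) (k : ℕ) (hk : 0 < (e : ℝ) * (x - (k * e : ℤ))) :
    MarksEdge (reflProd α (m + k)) (letterOf ((k * e : ℤ) : ℚ)) Letter.inf ![((k * e : ℤ) : ℝ), 1]
      ![(e : ℝ), 0] ∧ α (m + k + 1) ≠ letterOf (((k + 1) * e : ℤ) : ℚ) := by
  have he' : (e : ℝ) * e = 1 := by exact_mod_cast he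
  induction k with
  | zero => simpa using And.intro (by simpa using h0) hm
  | succ k ih =>
    have hk' : 0 < (e : ℝ) * (x - (k * e : ℤ)) := by
      push_cast at hk ⊢
      nlinarith
    obtain ⟨h1, h2⟩ := ih hk'
    have hd : (((k + 1) * e : ℤ) : ℝ) = ((k * e : ℤ) : ℝ) + e := by push_cast; ring
    have hstep := (hα.marksEdge_int_step he' hd h1 h2 hk').1 (by exact_mod_cast hk)
    -- The integers `k * e` and `(k + 2) * e` have the same letter, so the forbidden letter is the
    -- one just used.
    refine ⟨by exact_mod_cast hstep.2, fun h3 => ?_⟩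
    have h4 := hα.1 (m + k + 1) (by omega)
    rw [hstep.1, show m + k + 1 + 1 = m + (k + 1) + 1 by ring, h3] at h4
    have h5 : letterOf ((k * e : ℤ) : ℚ) ≠ letterOf (((k + 1) * e : ℤ) : ℚ) :=
      letterOf_intCast_ne (by linear_combination he)
    have h6 : letterOf ((((k + 1 : ℕ) + 1) * e : ℤ) : ℚ) ≠ letterOf (((k + 1) * e : ℤ) : ℚ) :=
      letterOf_intCast_ne (by push_cast; linear_combination he)
    rcases letter_cover h5 (letterOf_intCast_ne_inf _) (letterOf_intCast_ne_inf _)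
      (letterOf ((((k + 1 : ℕ) + 1) * e : ℤ) : ℚ)) with h7 | h7 | h7
    · exact h4 h7.symm
    · exact h6 h7
    · exact letterOf_intCast_ne_inf _ h7

/-- Source of the bound `|a₀| + 1`: it takes `|⌊x⌋|` letters to reach the triangle `⌊x⌋, ⌊x⌋ + 1,
∞`, and one more, `∞`, to cross its bottom side. -/
theorem IsDeltaExpr.marksEdge_floor (hx : Irrational x) :
    MarksEdge (reflProd α (⌊x⌋.natAbs + 1)) (letterOf ((⌊x⌋ : ℤ) : ℚ))
      (letterOf ((⌊x⌋ + 1 : ℤ) : ℚ)) (ratVec (⌊x⌋ : ℤ)) (ratVec (⌊x⌋ + 1 : ℤ)) ∧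
    α (⌊x⌋.natAbs + 1) = Letter.inf := by
  have hfl : (⌊x⌋ : ℝ) < x :=
    lt_of_le_of_ne (Int.floor_le x) fun h => hx ⟨⌊x⌋, by simpa using h⟩
  have hlt := Int.lt_floor_add_one x
  have hx0 : x ≠ 0 := fun h => hx ⟨0, by simp [h]⟩
  have l0 : letterOf ((0 : ℤ) : ℚ) = Letter.zero := by simp [letterOf]
  have l1 : letterOf ((1 : ℤ) : ℚ) = Letter.one := by simp [letterOf]
  have l2 : letterOf ((-1 : ℤ) : ℚ) = Letter.one := by simp [letterOf]
  have hI := hα.2 0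
  rw [reflProd, inv_one, one_smul, zero_add] at hI
  rcases lt_or_gt_of_ne hx0 with hneg | hpos
  · have h1 : α 1 = Letter.one := by
      revert hI
      cases α 1
      · intro hI
        have : 1 ≤ x := by simpa [bdryInterval] using hI
        linarith
      · exact fun _ => rfl
      · intro hI
        have : 0 ≤ x ∧ x ≤ 1 := by simpa [bdryInterval] using hI
        linarith
    have hn : ⌊x⌋ < 0 := Int.floor_lt.2 (by simpa using hneg)
    -- For negative `x` the first letter crosses the side `0 ∞`, and the leftward walk from `0`
    -- stops at the upper endpoint `⌊x⌋ + 1`.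
    obtain ⟨k, hk⟩ : ∃ k : ℕ, ⌊x⌋ + 1 = k * (-1) := ⟨(⌊x⌋ + 1).natAbs, by omega⟩
    have hk' : ⌊x⌋.natAbs = 1 + k := by omega
    have hpos' : 0 < ((-1 : ℤ) : ℝ) * (x - (k * (-1) : ℤ)) := by
      rw [← hk]; push_cast; linarith
    have h0 : MarksEdge (reflProd α 1) (letterOf ((0 : ℤ) : ℚ)) Letter.inf ![((0 : ℤ) : ℝ), 1]
        ![((-1 : ℤ) : ℝ), 0] := by
      refine ⟨1, one_ne_zero, ?_, ?_⟩ <;>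
        simp only [reflProd, one_mul, zero_add, h1, reflH_one_mulVec, l0] <;> simp [vertexVec]
    have h2 := hα.marksEdge_int (m := 1) (e := -1) (by norm_num) h0
      (by rw [l2, ← h1]; exact (hα.1 1 le_rfl).symm) k hpos'
    have hd : ((⌊x⌋ : ℤ) : ℝ) = ((k * (-1) : ℤ) : ℝ) + ((-1 : ℤ) : ℝ) := by
      rw [← hk]; push_cast; ring
    have h3 := (hα.marksEdge_int_step (by norm_num) hd h2.1
      (by rw [show ⌊x⌋ = (k + 1) * (-1) by linarith]; exact h2.2) hpos').2
      (by push_cast; linarith)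
    rw [← hk, ← hk'] at h3
    exact ⟨h3.2.symm, h3.1⟩
  · have h1 : α 1 ≠ Letter.one := by
      intro h1
      rw [h1] at hI
      have : x ≤ 0 := by simpa [bdryInterval] using hI
      linarith
    have hn : 0 ≤ ⌊x⌋ := Int.floor_nonneg.2 hpos.le
    obtain ⟨k, hk⟩ : ∃ k : ℕ, ⌊x⌋ = k * 1 := ⟨⌊x⌋.natAbs, by omega⟩
    have hk' : ⌊x⌋.natAbs = 0 + k := by omega
    have hpos' : 0 < ((1 : ℤ) : ℝ) * (x - (k * 1 : ℤ)) := by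
      rw [← hk]; push_cast; linarith
    have h0 : MarksEdge (reflProd α 0) (letterOf ((0 : ℤ) : ℚ)) Letter.inf ![((0 : ℤ) : ℝ), 1]
        ![((1 : ℤ) : ℝ), 0] := by
      refine ⟨1, one_ne_zero, ?_, ?_⟩ <;>
        simp only [reflProd, Units.val_one, one_mulVec, l0] <;> simp [vertexVec]
    have h2 := hα.marksEdge_int (m := 0) (e := 1) (by norm_num) h0 (by rw [l1]; exact h1) k hpos'
    have hd : ((⌊x⌋ + 1 : ℤ) : ℝ) = ((k * 1 : ℤ) : ℝ) + ((1 : ℤ) : ℝ) := by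
      rw [← hk]; push_cast; ring
    have h3 := (hα.marksEdge_int_step (by norm_num) hd h2.1
      (by rw [show ⌊x⌋ + 1 = (k + 1) * 1 by linarith]; exact h2.2) hpos').2
      (by push_cast; linarith)
    rw [← hk, ← hk'] at h3
    exact ⟨h3.2, h3.1⟩

/-- A triangle with vertices `r`, `s` and their mediant, reached through the side `r s`, is left
through the side between the mediant and the better of `r` and `s`. -/
theorem IsDeltaExpr.marksEdge_mediant (hx : Irrational x) {m : ℕ} {r s : ℚ} (h : FareyPair x r s)
    (hrs : |approxErr x r| < |approxErr x s|)
    (hM : MarksEdge (reflProd α m) (letterOf r) (letterOf s) (ratVec r) (ratVec s))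
    (hr : α m ≠ letterOf r) (hs : α m ≠ letterOf s) (hm : 1 ≤ m) :
    α (m + 1) = letterOf s ∧ MarksEdge (reflProd α (m + 1)) (letterOf r) (letterOf (mediant r s))
      (ratVec r) (ratVec (mediant r s)) := by
  have hne := h.letterOf_ne
  have hmed : letterOf (mediant r s) = α m := by
    rcases letter_cover hr hs hne (letterOf (mediant r s)) with h1 | h1 | h1
    · exact h1
    · exact absurd h1 h.letterOf_mediant.1
    · exact absurd h1 h.letterOf_mediant.2
  have hside := (h.mediant_right hx hrs.le).sides
  -- The letter `α m` would repeat, and the letter of `r` would put `x` between `s` and the mediant,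
  -- which lie on the same side of it.
  rcases letter_cover hr hs hne (α (m + 1)) with h1 | h1 | h1
  · exact absurd h1.symm (hα.1 m hm)
  · have h2 := hα.cross_mul_cross_nonpos hne.symm hs.symm hr.symm hM.symm h1
    rw [add_comm, ← h.ratVec_mediant, cross_ratVec, cross_ratVec] at h2
    have h3 := mul_pos_of_neg_of_neg h.sides hside
    have h4 : 0 < approxErr x r * approxErr x r := mul_self_pos.2 (approxErr_ne_zero hx r)
    nlinarith
  · refine ⟨h1, ?_⟩
    rw [reflProd, h1, hmed, h.ratVec_mediant]
    exact hM.reflH hne hr.symm hs.symm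

/-- The link between the two descriptions. The two inequalities say that the current letter is the
mediant's, so the triangle was entered through the Farey interval. -/
theorem IsDeltaExpr.marksEdge_fareySeq (hx : Irrational x) (t : ℕ) :
    MarksEdge (reflProd α (⌊x⌋.natAbs + 1 + t)) (letterOf (survivor x (fareySeq x t)))
      (letterOf (dropped x (fareySeq x t))) (ratVec (survivor x (fareySeq x t)))
      (ratVec (dropped x (fareySeq x t))) ∧
    α (⌊x⌋.natAbs + 1 + t) ≠ letterOf (survivor x (fareySeq x t)) ∧
    α (⌊x⌋.natAbs + 1 + t) ≠ letterOf (dropped x (fareySeq x t)) := by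
  induction t with
  | zero =>
    obtain ⟨h1, h2⟩ := hα.marksEdge_floor hx
    have h3 := letterOf_intCast_ne_inf ⌊x⌋
    have h4 := letterOf_intCast_ne_inf (⌊x⌋ + 1)
    rw [add_zero, h2]
    rcases survivor_dropped x (fareySeq x 0) with ⟨h5, h6, _⟩ | ⟨h5, h6, _⟩ <;> rw [h5, h6]
    · exact ⟨h1, h3.symm, h4.symm⟩
    · exact ⟨h1.symm, h4.symm, h3.symm⟩
  | succ t ih =>
    have hp := fareyPair_survivor_dropped hx t
    obtain ⟨h1, h2⟩ := hα.marksEdge_mediant hx hp (abs_survivor_lt_abs_dropped hx t) ih.1 ih.2.1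
      ih.2.2 (by omega)
    have h3 : α (⌊x⌋.natAbs + 1 + (t + 1)) = letterOf (dropped x (fareySeq x t)) := h1
    rw [h3]
    rcases survivor_dropped_succ (x := x) t with ⟨h5, h6⟩ | ⟨h5, h6⟩ <;> rw [h5, h6]
    · exact ⟨h2, hp.letterOf_ne.symm, hp.letterOf_mediant.2.symm⟩
    · exact ⟨h2.symm, hp.letterOf_mediant.2.symm, hp.letterOf_ne.symm⟩

theorem IsDeltaExpr.letter_succ (hx : Irrational x) (t : ℕ) :
    α (⌊x⌋.natAbs + 1 + t + 1) = letterOf (dropped x (fareySeq x t)) := by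
  have h := hα.marksEdge_fareySeq hx t
  exact (hα.marksEdge_mediant hx (fareyPair_survivor_dropped hx t)
    (abs_survivor_lt_abs_dropped hx t) h.1 h.2.1 h.2.2 (by omega)).1

/-- The tail alternates between the letters of the mediant and the dropped endpoint, so both
reflections fix the survivor. -/
theorem IsDeltaExpr.periodicTail_dropped_iff (hx : Irrational x) (t : ℕ) (y : OnePoint ℝ) :
    IsDeltaExpr (periodicTail α (⌊x⌋.natAbs + 1 + t) (letterOf (dropped x (fareySeq x t)))) y ↔
      y = ((survivor x (fareySeq x t) : ℝ) : OnePoint ℝ) := by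
  have h := hα.marksEdge_fareySeq hx t
  rw [isDeltaExpr_periodicTail_iff hα.1 (by omega) h.2.2 h.2.1
    (fareyPair_survivor_dropped hx t).letterOf_ne.symm, h.1.smul_vertex, pointOf_ratVec]

theorem IsDeltaExpr.periodicTail_survivor_iff (hx : Irrational x) (t : ℕ) (y : OnePoint ℝ) :
    IsDeltaExpr (periodicTail α (⌊x⌋.natAbs + 1 + t) (letterOf (survivor x (fareySeq x t)))) y ↔
      y = ((dropped x (fareySeq x t) : ℝ) : OnePoint ℝ) := by
  have h := hα.marksEdge_fareySeq hx t
  rw [isDeltaExpr_periodicTail_iff hα.1 (by omega) h.2.1 h.2.2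
    (fareyPair_survivor_dropped hx t).letterOf_ne, h.1.symm.smul_vertex, pointOf_ratVec]

end

/-! ### Matching the two descriptions -/

theorem abs_add_one_le_iff {n : ℤ} {m : ℕ} :
    |n| + 1 ≤ (m : ℤ) ↔ ∃ t, m = n.natAbs + 1 + t := by
  rw [Int.abs_eq_natAbs]
  constructor
  · exact fun h => ⟨m - (n.natAbs + 1), by omega⟩
  · rintro ⟨t, rfl⟩
    push_cast
    omega

theorem letters_pairwise_ne {a b c : Letter} (h : ({a, b, c} : Set Letter) = Set.univ) :
    a ≠ b ∧ a ≠ c ∧ b ≠ c := by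
  have h0 : Letter.zero ∈ ({a, b, c} : Set Letter) := h ▸ Set.mem_univ _
  have h1 : Letter.one ∈ ({a, b, c} : Set Letter) := h ▸ Set.mem_univ _
  have h2 : Letter.inf ∈ ({a, b, c} : Set Letter) := h ▸ Set.mem_univ _
  clear h
  cases a <;> cases b <;> cases c <;> simp_all

theorem theorem2 (x : ℝ) (hx : Irrational x) (α : ℕ → Letter)
    (hα : IsDeltaExpr α (x : OnePoint ℝ)) (δ : ℕ → Letter)
    (hδ : ∀ m, 1 ≤ m → ({α m, α (m + 1), δ (m + 1)} : Set Letter) = Set.univ) :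
    (∀ m, 1 ≤ m → ∀ c, c ≠ α m → ∃! y, IsDeltaExpr (periodicTail α m c) y) ∧
    asBoundary (bestApprox x) =
      {y | ∃ m : ℕ, |⌊x⌋| + 1 ≤ (m : ℤ) ∧ IsDeltaExpr (periodicTail α m (α (m + 1))) y} ∧
    asBoundary (bestSigned x) =
      {y | ∃ m : ℕ, |⌊x⌋| + 1 ≤ (m : ℤ) ∧ IsDeltaExpr (periodicTail α m (δ (m + 1))) y} ∧
    (∀ a : Letter, asBoundary (bestApproxOne a x) =
      {y | ∃ m : ℕ, α (m + 1) = a ∧ |⌊x⌋| + 1 ≤ (m : ℤ) ∧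
        IsDeltaExpr (periodicTail α m (δ (m + 1))) y}) ∧
    (∀ a b c : Letter, ({a, b, c} : Set Letter) = Set.univ →
      asBoundary (bestApproxTwo a b x) =
        {y | ∃ m : ℕ, α m ≠ c ∧ |⌊x⌋| + 1 ≤ (m : ℤ) ∧
          IsDeltaExpr (periodicTail α m c) y}) := by
  have hsucc := hα.letter_succ hx
  -- Mediant and dropped endpoint use up the letters `α m` and `α (m + 1)`, which leaves the
  -- survivor's.
  have hδsucc : ∀ t, δ (⌊x⌋.natAbs + 1 + t + 1) = letterOf (survivor x (fareySeq x t)) := by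
    intro t
    obtain ⟨h1, h2, h3⟩ := letters_pairwise_ne (hδ (⌊x⌋.natAbs + 1 + t) (by omega))
    have h4 := hα.marksEdge_fareySeq hx t
    rw [hsucc] at h3
    rcases letter_cover h4.2.1 h4.2.2 (fareyPair_survivor_dropped hx t).letterOf_ne
      (δ (⌊x⌋.natAbs + 1 + t + 1)) with h5 | h5 | h5
    · exact absurd h5.symm h2
    · exact h5
    · exact absurd h5.symm h3
  refine ⟨fun m hm c hc => ?_, ?_, ?_, fun a => ?_, fun a b c habc => ?_⟩
  · obtain ⟨d, hd, hcd⟩ := exists_third hc.symm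
    exact ⟨_, (isDeltaExpr_periodicTail_iff hα.1 hm hc.symm hd hcd _).2 rfl,
      fun y hy => (isDeltaExpr_periodicTail_iff hα.1 hm hc.symm hd hcd y).1 hy⟩
  · rw [bestApprox_eq hx]
    ext y
    constructor
    · rintro ⟨_, ⟨t, rfl⟩, rfl⟩
      refine ⟨_, abs_add_one_le_iff.2 ⟨t, rfl⟩, ?_⟩
      rw [hsucc, hα.periodicTail_dropped_iff hx]
    · rintro ⟨m, hm, hy⟩
      obtain ⟨t, rfl⟩ := abs_add_one_le_iff.1 hm
      rw [hsucc, hα.periodicTail_dropped_iff hx] at hy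
      exact ⟨_, ⟨t, rfl⟩, hy.symm⟩
  · rw [bestSigned_eq hx]
    ext y
    constructor
    · rintro ⟨_, ⟨t, rfl⟩, rfl⟩
      refine ⟨_, abs_add_one_le_iff.2 ⟨t, rfl⟩, ?_⟩
      rw [hδsucc, hα.periodicTail_survivor_iff hx]
    · rintro ⟨m, hm, hy⟩
      obtain ⟨t, rfl⟩ := abs_add_one_le_iff.1 hm
      rw [hδsucc, hα.periodicTail_survivor_iff hx] at hy
      exact ⟨_, ⟨t, rfl⟩, hy.symm⟩
  · rw [bestApproxOne_eq hx]
    ext y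
    constructor
    · rintro ⟨_, ⟨t, ha, rfl⟩, rfl⟩
      refine ⟨_, (hsucc t).trans ha, abs_add_one_le_iff.2 ⟨t, rfl⟩, ?_⟩
      rw [hδsucc, hα.periodicTail_survivor_iff hx]
    · rintro ⟨m, ha, hm, hy⟩
      obtain ⟨t, rfl⟩ := abs_add_one_le_iff.1 hm
      rw [hδsucc, hα.periodicTail_survivor_iff hx] at hy
      exact ⟨_, ⟨t, (hsucc t).symm.trans ha, rfl⟩, hy.symm⟩
  · obtain ⟨hab, hac, hbc⟩ := letters_pairwise_ne habc
    rw [bestApproxTwo_eq hx hab hac hbc]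
    ext y
    constructor
    · rintro ⟨_, ⟨t, ⟨rfl, rfl⟩ | ⟨rfl, rfl⟩⟩, rfl⟩
      · refine ⟨_, (hα.marksEdge_fareySeq hx t).2.2, abs_add_one_le_iff.2 ⟨t, rfl⟩, ?_⟩
        rw [hα.periodicTail_dropped_iff hx]
      · refine ⟨_, (hα.marksEdge_fareySeq hx t).2.1, abs_add_one_le_iff.2 ⟨t, rfl⟩, ?_⟩
        rw [hα.periodicTail_survivor_iff hx]
    · rintro ⟨m, hmc, hm, hy⟩
      obtain ⟨t, rfl⟩ := abs_add_one_le_iff.1 hm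
      have h := hα.marksEdge_fareySeq hx t
      -- Since `c` is not the mediant's letter, it labels one endpoint, and the tail represents the
      -- other.
      rcases letter_cover h.2.1 h.2.2 (fareyPair_survivor_dropped hx t).letterOf_ne c with
        h1 | h1 | h1
      · exact absurd h1.symm hmc
      · rw [h1, hα.periodicTail_survivor_iff hx] at hy
        exact ⟨_, ⟨t, Or.inr ⟨rfl, h1.symm⟩⟩, hy.symm⟩
      · rw [h1, hα.periodicTail_dropped_iff hx] at hy
        exact ⟨_, ⟨t, Or.inl ⟨rfl, h1.symm⟩⟩, hy.symm⟩
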